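/- Let $(\lambda_n)_{n\ge1}$ and $(\mu_n)_{n\ge1}$ be strictly increasing sequences of positive real numbers tending to $\infty$, let $(a_n),(b_n)$ be sequences of complex numbers, and suppose that the Dirichlet series $\phi(s)=\sum_{n\ge1}a_n\lambda_n^{-s}$ and $\psi(s)=\sum_{n\ge1}b_n\mu_n^{-s}$ have finite abscissae of absolute convergence $\sigma_a$ and $\sigma_b$ respectively. Let $r\ge1$, $\alpha_i>0$, $\beta_i\in\mathbb C$ with $\Re(\beta_i)\ge0$ $(1\le i\le r)$, $Q>0$, $\delta>0$ and $\omega\in\mathbb C$ with $|\omega|=1$, and put $$F(s)=\phi(s)\prod_{i=1}^r\Gamma(\alpha_is+\beta_i),\qquad G(s)=\psi(s)\prod_{i=1}^r\Gamma(\alpha_is+\beta_i).$$ Suppose that the functional equation $$Q^sF(s)=\omega Q^{\delta-s}\,\overline{G(\delta-\bar s)}$$ holds in the following sense: there are a compact set $S\subset\mathbb C$ whose complement $D=\mathbb C\setminus S$ is connected and an analytic function $\chi$ on $D$ such that (i) for $s\in D$, $\chi(s)=Q^sF(s)$ if $\Re(s)>\sigma_a$, and $\chi(s)=\omega Q^{\delta-s}\,\overline{G(\delta-\bar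 s)}$ if $\Re(s)<\delta-\sigma_b$ (at poles of the Gamma factors, in the sense of limits); (ii) there is a constant $\theta<1$ such that for all real $\sigma_1<\sigma_2$, $$\chi(s)=O\left(\exp\left[\exp\left(\frac{\theta\pi|s|}{\sigma_2-\sigma_1}\right)\right]\right)\qquad\text{as } |s|\to\infty,\ \text{uniformly in } \sigma_1\le\Re(s)\le\sigma_2.$$ Denote by $F(s)=Q^{-s}\chi(s)$ also the continuation of $F$ to $D$. Let $C\subset D$ be a (positively oriented) circle of finite positive radius that contains all the singularities of $F$ in its interior; that is, $F$ extends analytically to the whole exterior of $C$. Put $$P(x)=\frac1{2\pi i}\int_CF(s)x^{-s}\,ds\qquad(x>0),$$ and, for a real number $a>0$ and $\boldsymbol\alpha=(\alpha_1,\dots,\alpha_r)$, $\boldsymbol\beta=(\beta_1,\dots,\beta_r)$, $\boldsymbol{\bar\beta}=(\bar\beta_1,\dots,\bar\beta_r)$, $$Z_{\boldsymbol\alpha,\boldsymbol\beta}(x)=\frac1{2\pi i}\int_{a-i\infty}^{a+i\infty}\prod_{i=1}^r\Gamma(\alpha_is+\beta_i)\,x^{-s}\,ds\qquad(x>0).$$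 Then, for every $a>0$, the integrals defining $Z_{\boldsymbol\alpha,\boldsymbol\beta}(x)$ and $Z_{\boldsymbol\alpha,\boldsymbol{\bar\beta}}(x)$ converge absolutely for all $x>0$, and for all $x>0$ the modular relation $$\sum_{n=1}^\infty a_nZ_{\boldsymbol\alpha,\boldsymbol\beta}(\lambda_nx)=P(x)+\frac{\omega}{(xQ)^\delta}\sum_{n=1}^\infty\overline{b_n}\,Z_{\boldsymbol\alpha,\boldsymbol{\bar\beta}}\left(\frac{\mu_n}{Q^2x}\right)$$ holds, both series converging absolutely. Moreover, $P$ is a residual function with respect to $D$: it is differentiable on $(0,\infty)$; for some $c>0$, $P(x)=O(x^{-c})$ as $x\to0^+$ and $P(x)=O(x^c)$ as $x\to\infty$; the functions $I_1(s)=\int_0^1P(x)x^{s-1}\,dx$ and $I_2(s)=-\int_1^\infty P(x)x^{s-1}\,dx$, which are defined by absolutely convergent integrals in some right half-plane and in some left half-plane respectively, have a common analytic continuation $I$ to $D$; and $I(\sigma+it)\to0$ as $|t|\to\infty$, uniformly in $\sigma_1\le\sigma\le\sigma_2$ for all real $\sigma_1\le\sigma_2$. -/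

import Mathlib

open Complex Filter Topology Asymptotics Set MeasureTheory

noncomputable section

/-- The generalized Dirichlet series `∑ c n / (ν n) ^ s`. -/
def dirichletSeries (c : ℕ → ℂ) (ν : ℕ → ℝ) (s : ℂ) : ℂ :=
  ∑' n, c n / (ν n : ℂ) ^ s

/-- The abscissa of absolute convergence of `∑ c n / (ν n) ^ s`, an extended real number. -/
def abscissaAbs (c : ℕ → ℂ) (ν : ℕ → ℝ) : EReal :=
  sInf ((fun x : ℝ => (x : EReal)) '' {x : ℝ | Summable fun n => ‖c n‖ / ν n ^ x})

/-- `∑ c n / (ν n) ^ s` is a Dirichlet series with positive frequencies strictly increasing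
to infinity and with finite abscissa of absolute convergence `σ`.
(Finiteness excludes `c = 0`, whose abscissa is `⊥`.) -/
structure IsDirichletSeries (c : ℕ → ℂ) (ν : ℕ → ℝ) (σ : ℝ) : Prop where
  pos : ∀ n, 0 < ν n
  strictMono : StrictMono ν
  tendsto : Tendsto ν atTop atTop
  abscissa : abscissaAbs c ν = (σ : EReal)

/-- The product of Gamma factors `∏ Γ(α i * s + β i)`. -/
def gammaFactor {r : ℕ} (α : Fin r → ℝ) (β : Fin r → ℂ) (s : ℂ) : ℂ :=
  ∏ i, Complex.Gamma (α i * s + β i)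

/-- `s` is a pole of one of the factors `Γ(α i * s + β i)`. -/
def IsGammaPole {r : ℕ} (α : Fin r → ℝ) (β : Fin r → ℂ) (s : ℂ) : Prop :=
  ∃ (i : Fin r) (m : ℕ), (α i : ℂ) * s + β i = -(m : ℂ)

/-- The completed series `(∑ c n / (ν n) ^ s) * ∏ Γ(α i * s + β i)`, on the half-plane of
absolute convergence of the series. -/
def completedSeries {r : ℕ} (c : ℕ → ℂ) (ν : ℕ → ℝ) (α : Fin r → ℝ) (β : Fin r → ℂ)
    (s : ℂ) : ℂ :=
  dirichletSeries c ν s * gammaFactor α β s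

/-- The functional equation `Q ^ s F(s) = ω Q ^ (δ - s) conj (G (δ - conj s))`:
the domain `D = Sᶜ` is the exterior of a compact set `S`, and `χ` is analytic in `D`, is equal
to the left side for `Re s > σa`, to the right side for `Re s < δ - σb`, and has at most
double exponential growth at infinity in vertical strips.
The two identities are required off the poles of the Gamma factors (where Mathlib's `Gamma` has
the conventional value `0`); at a pole that lies in `D`, they hold in the limit. -/
structure FunctionalEquation {r : ℕ} (a : ℕ → ℂ) (lam : ℕ → ℝ) (σa : ℝ)
    (b : ℕ → ℂ) (mu : ℕ → ℝ) (σb : ℝ) (α : Fin r → ℝ) (β : Fin r → ℂ)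
    (Q δ : ℝ) (ω : ℂ) (S : Set ℂ) (χ : ℂ → ℂ) : Prop where
  isCompact : IsCompact S
  isConnected : IsConnected Sᶜ
  analytic : AnalyticOnNhd ℂ χ Sᶜ
  eq_right : ∀ s ∈ Sᶜ, σa < s.re → ¬ IsGammaPole α β s →
    χ s = (Q : ℂ) ^ s * completedSeries a lam α β s
  eq_left : ∀ s ∈ Sᶜ, s.re < δ - σb → ¬ IsGammaPole α β (δ - (starRingEnd ℂ) s) →
    χ s = ω * (Q : ℂ) ^ ((δ : ℂ) - s) *
      (starRingEnd ℂ) (completedSeries b mu α β (δ - (starRingEnd ℂ) s))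
  growth : ∃ θ : ℝ, θ < 1 ∧ ∀ σ₁ σ₂ : ℝ, σ₁ < σ₂ →
    χ =O[Bornology.cobounded ℂ ⊓ 𝓟 {s : ℂ | σ₁ ≤ s.re ∧ s.re ≤ σ₂}]
      fun s => Real.exp (Real.exp (θ * Real.pi * ‖s‖ / (σ₂ - σ₁)))

/-- The analytic continuation `Q ^ (-s) * χ s` of the completed series `F` to the domain `D`
on which `χ` is analytic. -/
def continuedF (Q : ℝ) (χ : ℂ → ℂ) (s : ℂ) : ℂ :=
  (Q : ℂ) ^ (-s) * χ s

/-- The circle with centre `c` and radius `R > 0` lies in `Sᶜ`, and all the singularities of `F`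
(an analytic function on `Sᶜ`) lie inside it, i.e. `F` extends analytically to the whole
exterior of the circle. This holds in particular if the open disc contains `S`. -/
def CircleEnclosesSingularities (S : Set ℂ) (F : ℂ → ℂ) (c : ℂ) (R : ℝ) : Prop :=
  0 < R ∧ Metric.sphere c R ⊆ Sᶜ ∧
    ∃ g : ℂ → ℂ, AnalyticOnNhd ℂ g (Sᶜ ∪ (Metric.closedBall c R)ᶜ) ∧ EqOn g F Sᶜ

/-- `Z(x) = (1 / 2πi) ∫ ∏ Γ(α i * s + β i) x ^ (-s) ds` over the line `Re s = κ`. -/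
def zFun {r : ℕ} (α : Fin r → ℝ) (β : Fin r → ℂ) (κ : ℝ) (x : ℝ) : ℂ :=
  mellinInv κ (gammaFactor α β) x

/-- `P(x) = (1 / 2πi) ∮ F(s) x ^ (-s) ds` over the circle with centre `c` and radius `R`. -/
def residualIntegral (F : ℂ → ℂ) (c : ℂ) (R : ℝ) (x : ℝ) : ℂ :=
  (2 * Real.pi * I : ℂ)⁻¹ * ∮ s in C(c, R), F s * (x : ℂ) ^ (-s)

/-- Residual functions in the sense of Bochner, with respect to the domain `Sᶜ`. -/
structure IsResidualFunction (S : Set ℂ) (P : ℝ → ℂ) : Prop where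
  differentiable : DifferentiableOn ℝ P (Ioi 0)
  growth : ∃ c : ℝ, 0 < c ∧ P =O[𝓝[>] (0 : ℝ)] (fun x => x ^ (-c)) ∧
    P =O[atTop] (fun x => x ^ c)
  continuation : ∃ J : ℂ → ℂ, AnalyticOnNhd ℂ J Sᶜ ∧
    (∃ c : ℝ, ∀ s : ℂ, c < s.re →
      IntegrableOn (fun x : ℝ => P x * (x : ℂ) ^ (s - 1)) (Ioc 0 1) ∧
      J s = ∫ x in Ioc (0 : ℝ) 1, P x * (x : ℂ) ^ (s - 1)) ∧
    (∃ c : ℝ, ∀ s : ℂ, s.re < c →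
      IntegrableOn (fun x : ℝ => P x * (x : ℂ) ^ (s - 1)) (Ioi 1) ∧
      J s = -∫ x in Ioi (1 : ℝ), P x * (x : ℂ) ^ (s - 1)) ∧
    ∀ σ₁ σ₂ : ℝ, σ₁ ≤ σ₂ →
      Tendsto J (Bornology.cobounded ℂ ⊓ 𝓟 {s : ℂ | σ₁ ≤ s.re ∧ s.re ≤ σ₂}) (𝓝 0)

end

/-!
Outside the circle, the analytic extension of `F` is the sum of an entire function and the
principal part of `F`, which is minus the Cauchy integral of `F` over the circle. The principal part
vanishes at infinity. It is the Mellin transform of `P` over `(0, 1)` for `Re s` large, and minus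
that over `(1, ∞)` for `-Re s` large; hence `P` is residual.

For the modular relation, the Gamma factors give `F(s) = O(|s|⁻²)` on a line `Re s = κ` far to the
right and, by the functional equation, on `Re s = δ - κ`. The growth condition and the
Phragmén–Lindelöf principle, applied to `s² F(s)` after its principal part is subtracted, extend the
bound to the strip in between. Moving the line of integration of `F(s) x⁻ˢ` from `κ` to `δ - κ`
therefore picks up exactly `P(x)`, and the reflection `s ↦ δ - s` turns the integral on the left
into the second series.
-/

/-- The filter of neighbourhoods of infinity in the closed vertical strip `a ≤ re s ≤ b`. -/
noncomputable def stripAtInfty (a b : ℝ) : Filter ℂ :=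
  Bornology.cobounded ℂ ⊓ 𝓟 {s | a ≤ s.re ∧ s.re ≤ b}

section Strip

variable {a b : ℝ}

theorem eventually_mem_strip (a b : ℝ) : ∀ᶠ s in stripAtInfty a b, a ≤ s.re ∧ s.re ≤ b :=
  mem_inf_of_right (mem_principal_self _)

theorem stripAtInfty_le_cobounded (a b : ℝ) : stripAtInfty a b ≤ Bornology.cobounded ℂ :=
  inf_le_left

theorem stripAtInfty_mono {a' b' : ℝ} (ha : a' ≤ a) (hb : b ≤ b') :
    stripAtInfty a b ≤ stripAtInfty a' b' :=
  inf_le_inf_left _ (principal_mono.2 fun _ hs => ⟨ha.trans hs.1, hs.2.trans hb⟩)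

theorem tendsto_horizontal_stripAtInfty (a b : ℝ) :
    Tendsto (fun p : ℝ × ℝ => (p.2 : ℂ) + p.1 * I) (cocompact ℝ ×ˢ 𝓟 (Icc a b))
      (stripAtInfty a b) := by
  refine tendsto_inf.2 ⟨tendsto_norm_atTop_iff_cobounded.1 ?_, tendsto_principal.2 ?_⟩
  · refine tendsto_atTop_mono (fun p => ?_)
      ((tendsto_norm_cocompact_atTop (E := ℝ)).comp tendsto_fst)
    simpa using abs_im_le_norm ((p.2 : ℂ) + p.1 * I)
  · filter_upwards [prod_mem_prod univ_mem (mem_principal_self (Icc a b))] with p hp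
    simpa using hp.2

theorem tendsto_vertical_stripAtInfty {κ : ℝ} (ha : a ≤ κ) (hb : κ ≤ b) :
    Tendsto (fun y : ℝ => (κ : ℂ) + y * I) (cocompact ℝ) (stripAtInfty a b) :=
  (tendsto_horizontal_stripAtInfty a b).comp
    (tendsto_id.prodMk (tendsto_principal.2 (Eventually.of_forall fun _ => ⟨ha, hb⟩)))

theorem continuous_vertical {f : ℂ → ℂ} {κ : ℝ}
    (hf : ∀ z : ℂ, z.re = κ → DifferentiableAt ℂ f z) :
    Continuous fun y : ℝ => f (κ + y * I) :=
  continuous_iff_continuousAt.2 fun y =>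
    ContinuousAt.comp (hf _ (by simp)).continuousAt (by fun_prop)

theorem verticalIntegrable_of_isBigO_inv_sq {f : ℂ → ℂ} {κ : ℝ}
    (hf : ∀ z : ℂ, z.re = κ → DifferentiableAt ℂ f z)
    (hO : f =O[stripAtInfty κ κ] fun s => (s ^ 2)⁻¹) : VerticalIntegrable f κ := by
  have hline : (fun y : ℝ => (((κ : ℂ) + y * I) ^ 2)⁻¹) =O[cocompact ℝ]
      fun y => (1 + y ^ 2)⁻¹ := by
    refine IsBigO.of_bound 2 ?_
    filter_upwards [(tendsto_norm_cocompact_atTop (E := ℝ)).eventually_ge_atTop 1] with y hy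
    have hy1 : 1 ≤ y ^ 2 := by rwa [← sq_abs, one_le_sq_iff₀ (abs_nonneg y)]
    rw [norm_inv, norm_pow, Complex.sq_norm, normSq_add_mul_I, norm_inv,
      Real.norm_of_nonneg (by positivity), ← div_eq_mul_inv, le_div_iff₀ (by positivity),
      inv_mul_le_iff₀ (by positivity)]
    nlinarith [sq_nonneg κ]
  exact (continuous_vertical hf).locallyIntegrable.integrable_of_isBigO_cocompact
    ((hO.comp_tendsto (tendsto_vertical_stripAtInfty le_rfl le_rfl)).trans hline)
    (integrable_inv_one_add_sq.integrableAtFilter _)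

theorem norm_ofReal_cpow_neg {x : ℝ} (hx : 0 < x) (s : ℂ) : ‖(x : ℂ) ^ (-s)‖ = x ^ (-s.re) := by
  rw [norm_cpow_eq_rpow_re_of_pos hx, neg_re]

theorem differentiable_ofReal_cpow_neg {x : ℝ} (hx : 0 < x) :
    Differentiable ℂ fun s : ℂ => (x : ℂ) ^ (-s) := fun _ =>
  differentiableAt_id.neg.const_cpow (.inl (ofReal_ne_zero.2 hx.ne'))

theorem isBigO_ofReal_cpow_neg_mul {E : Type*} [SeminormedAddCommGroup E] {x : ℝ} (hx : 0 < x)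
    {f : ℂ → ℂ} {g : ℂ → E} (hf : f =O[stripAtInfty a b] g) :
    (fun s : ℂ => (x : ℂ) ^ (-s) * f s) =O[stripAtInfty a b] g := by
  obtain ⟨C, hC⟩ := isCompact_Icc (a := a) (b := b) |>.exists_bound_of_continuousOn
    ((Real.continuous_const_rpow hx.ne').comp continuous_neg).continuousOn
  have hbdd : (fun s : ℂ => (x : ℂ) ^ (-s)) =O[stripAtInfty a b] fun _ => (1 : ℝ) := by
    refine IsBigO.of_bound C ?_
    filter_upwards [eventually_mem_strip a b] with s hs
    simpa [norm_ofReal_cpow_neg hx] using (le_abs_self _).trans (hC s.re hs)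
  simpa using hbdd.mul hf.norm_right

theorem verticalIntegrable_cpow_neg_mul {f : ℂ → ℂ} {κ x : ℝ} (hx : 0 < x)
    (hf : VerticalIntegrable f κ) : VerticalIntegrable (fun s => (x : ℂ) ^ (-s) * f s) κ := by
  refine Integrable.bdd_mul (c := x ^ (-κ)) hf (Continuous.aestronglyMeasurable ?_)
    (Eventually.of_forall fun y => ?_)
  · exact (differentiable_ofReal_cpow_neg hx).continuous.comp (by fun_prop)
  · rw [norm_ofReal_cpow_neg hx]
    simp

theorem tendsto_inv_sq_stripAtInfty (a b : ℝ) :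
    Tendsto (fun s : ℂ => (s ^ 2)⁻¹) (stripAtInfty a b) (𝓝 0) := by
  have := (tendsto_inv₀_cobounded (α := ℂ)).pow 2
  simp only [zero_pow two_ne_zero, inv_pow] at this
  exact this.mono_left (stripAtInfty_le_cobounded a b)

theorem mellinInv_sub_mellinInv {f : ℂ → ℂ} {x : ℝ}
    (ha : VerticalIntegrable (fun s => (x : ℂ) ^ (-s) * f s) a)
    (hb : VerticalIntegrable (fun s => (x : ℂ) ^ (-s) * f s) b) :
    mellinInv b f x - mellinInv a f x = (2 * Real.pi * I : ℂ)⁻¹ *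
      (I * ∫ y : ℝ, ((x : ℂ) ^ (-(b + y * I)) * f (b + y * I) -
        (x : ℂ) ^ (-(a + y * I)) * f (a + y * I))) := by
  have hconst : (2 * Real.pi * I : ℂ)⁻¹ * I = (1 / (2 * Real.pi) : ℝ) := by
    push_cast
    field_simp
  rw [integral_sub hb ha, ← mul_assoc, hconst]
  simp only [mellinInv, smul_eq_mul, real_smul, mul_sub]

theorem tendsto_integral_horizontal {f : ℂ → ℂ} (hab : a ≤ b)
    (hlim : Tendsto f (stripAtInfty a b) (𝓝 0)) :
    Tendsto (fun T : ℝ => ∫ x : ℝ in a..b, f (x + T * I)) (cocompact ℝ) (𝓝 0) := by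
  refine Metric.tendsto_nhds.2 fun ε hε => ?_
  obtain ⟨η, hη, hηε⟩ := exists_pos_mul_lt hε |b - a|
  have hsmall := eventually_prod_principal_iff.1 <|
    (hlim.comp (tendsto_horizontal_stripAtInfty a b)).eventually (Metric.ball_mem_nhds 0 hη)
  filter_upwards [hsmall] with T hT
  rw [dist_zero_right]
  refine (intervalIntegral.norm_integral_le_of_norm_le_const fun x hx => ?_).trans_lt
    ((mul_comm _ _).trans_lt hηε)
  rw [uIoc_of_le hab] at hx
  simpa using (hT x (Ioc_subset_Icc_self hx)).le

theorem integral_vertical_sub_eq_zero {f : ℂ → ℂ} (hab : a ≤ b)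
    (hf : ∀ z : ℂ, a ≤ z.re → z.re ≤ b → DifferentiableAt ℂ f z)
    (hlim : Tendsto f (stripAtInfty a b) (𝓝 0))
    (hint : Integrable fun y : ℝ => f (b + y * I) - f (a + y * I)) :
    ∫ y : ℝ, (f (b + y * I) - f (a + y * I)) = 0 := by
  have hedge := tendsto_integral_horizontal hab hlim
  have hcont : ∀ κ ∈ Icc a b, Continuous fun y : ℝ => f (κ + y * I) := fun κ hκ =>
    continuous_vertical fun z hz => hf z (hz ▸ hκ.1) (hz ▸ hκ.2)
  have hrect : ∀ T : ℝ, I * ∫ y : ℝ in (-T)..T, (f (b + y * I) - f (a + y * I)) =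
      (∫ x : ℝ in a..b, f (x + T * I)) - ∫ x : ℝ in a..b, f (x + (-T : ℝ) * I) := fun T => by
    have h := integral_boundary_rect_eq_zero_of_differentiableOn f (a + (-T : ℝ) * I) (b + T * I)
      fun z hz => by
        have hz := hz.1
        simp only [add_re, ofReal_re, re_ofReal_mul, I_re, mul_zero, add_zero, uIcc_of_le hab,
          mem_preimage] at hz
        exact (hf z hz.1 hz.2).differentiableWithinAt
    simp only [add_re, ofReal_re, re_ofReal_mul, I_re, mul_zero, add_zero, add_im, ofReal_im,
      im_ofReal_mul, I_im, mul_one, zero_add, smul_eq_mul] at h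
    rw [intervalIntegral.integral_sub ((hcont b (right_mem_Icc.2 hab)).intervalIntegrable _ _)
      ((hcont a (left_mem_Icc.2 hab)).intervalIntegrable _ _)]
    linear_combination h
  have hlim' : Tendsto (fun T : ℝ => I * ∫ y : ℝ in (-T)..T, (f (b + y * I) - f (a + y * I)))
      atTop (𝓝 0) := by
    simp only [hrect]
    simpa using (hedge.comp (tendsto_id.mono_right atTop_le_cocompact)).sub
      (hedge.comp (tendsto_neg_atTop_atBot.mono_right atBot_le_cocompact))
  have h0 := tendsto_nhds_unique hlim'
    ((intervalIntegral_tendsto_integral hint tendsto_neg_atTop_atBot tendsto_id).const_mul I)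
  simpa using h0.symm

theorem mellinInv_congr_line {f : ℂ → ℂ} {x : ℝ} (hx : 0 < x) (hab : a ≤ b)
    (hf : ∀ z : ℂ, a ≤ z.re → z.re ≤ b → DifferentiableAt ℂ f z)
    (hO : f =O[stripAtInfty a b] fun s => (s ^ 2)⁻¹) : mellinInv a f x = mellinInv b f x := by
  have hint : ∀ κ ∈ Icc a b, VerticalIntegrable (fun s => (x : ℂ) ^ (-s) * f s) κ := fun κ hκ =>
    verticalIntegrable_cpow_neg_mul hx <| verticalIntegrable_of_isBigO_inv_sq
      (fun z hz => hf z (hz ▸ hκ.1) (hz ▸ hκ.2)) (hO.mono (stripAtInfty_mono hκ.1 hκ.2))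
  have ha := hint a (left_mem_Icc.2 hab)
  have hb := hint b (right_mem_Icc.2 hab)
  have h0 := integral_vertical_sub_eq_zero hab (f := fun s => (x : ℂ) ^ (-s) * f s)
    (fun z hz hz' => (differentiable_ofReal_cpow_neg hx z).mul (hf z hz hz'))
    ((isBigO_ofReal_cpow_neg_mul hx hO).trans_tendsto (tendsto_inv_sq_stripAtInfty a b))
    (hb.sub ha)
  have hsub := mellinInv_sub_mellinInv ha hb
  rw [h0, mul_zero, mul_zero, sub_eq_zero] at hsub
  exact hsub.symm

end Strip

/-- The principal part of a function analytic outside a disc: its Cauchy integral over the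
boundary circle. The kernel has the sign `s - w`, so that this is the part of the Laurent series
with negative exponents at points `s` outside the disc. -/
noncomputable def principalPart (g : ℂ → ℂ) (c : ℂ) (R : ℝ) (s : ℂ) : ℂ :=
  (2 * Real.pi * I : ℂ)⁻¹ * ∮ w in C(c, R), (s - w)⁻¹ * g w

section PrincipalPart

variable {g : ℂ → ℂ} {c s : ℂ} {R ρ : ℝ}

theorem continuousOn_sphere_of_differentiableAt
    (hg : ∀ z, R ≤ dist z c → DifferentiableAt ℂ g z) (hρ : R ≤ ρ) :
    ContinuousOn g (Metric.sphere c ρ) := fun z hz =>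
  (hg z (hρ.trans (Metric.mem_sphere.1 hz).ge)).continuousAt.continuousWithinAt

theorem principalPart_eq_neg_cauchyIntegral (g : ℂ → ℂ) (c : ℂ) (R : ℝ) (s : ℂ) :
    principalPart g c R s = -((2 * Real.pi * I : ℂ)⁻¹ • ∮ z in C(c, R), (z - s)⁻¹ • g z) := by
  have hkernel : ∀ z, (s - z)⁻¹ * g z = -1 * ((z - s)⁻¹ * g z) := fun z => by
    rw [← neg_sub, inv_neg, neg_one_mul, neg_mul]
  simp only [principalPart, smul_eq_mul, hkernel, circleIntegral.integral_const_mul]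
  ring

theorem tendsto_principalPart (hR : 0 ≤ R) (hg : ContinuousOn g (Metric.sphere c R)) :
    Tendsto (principalPart g c R) (Bornology.cobounded ℂ) (𝓝 0) := by
  obtain ⟨M, hM⟩ := (isCompact_sphere c R).exists_bound_of_continuousOn hg
  have hfar := tendsto_norm_cobounded_atTop (E := ℂ)
  have hlim := ((tendsto_inv_atTop_zero.comp
    (tendsto_atTop_add_const_right _ (-(‖c‖ + R)) hfar)).mul_const M).const_mul R
  rw [zero_mul, mul_zero] at hlim
  refine squeeze_zero_norm' ?_ hlim
  filter_upwards [hfar.eventually_gt_atTop (‖c‖ + R)] with s hs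
  refine circleIntegral.norm_two_pi_i_inv_smul_integral_le_of_norm_le_const hR fun w hw => ?_
  have hdist : ‖s‖ + -(‖c‖ + R) ≤ ‖s - w‖ := by
    linarith [norm_sub_norm_le s w, norm_sub_norm_le w c, mem_sphere_iff_norm.1 hw]
  rw [norm_mul, norm_inv, Function.comp_apply]
  have : 0 < ‖s‖ + -(‖c‖ + R) := by linarith
  gcongr
  exact hM w hw

theorem principalPart_congr_radius (hR : 0 < R)
    (hg : ∀ z, R ≤ dist z c → DifferentiableAt ℂ g z) (hs : dist s c < R) (hρ : R ≤ ρ) :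
    principalPart g c ρ s = principalPart g c R s := by
  have hd : ∀ z, R ≤ dist z c → DifferentiableAt ℂ (fun z => (s - z)⁻¹ * g z) z := fun z hz =>
    ((differentiableAt_id.const_sub s).inv
      (sub_ne_zero.2 fun h => (hs.trans_le hz).ne (h ▸ rfl))).mul (hg z hz)
  simp only [principalPart]
  rw [circleIntegral_eq_of_differentiable_on_annulus_off_countable hR hρ countable_empty
    (fun z hz => (hd z (by simpa using hz.2)).continuousAt.continuousWithinAt)
    (fun z hz => hd z (le_of_lt (by simpa using hz.1.2)))]

theorem differentiableAt_principalPart (hg : ContinuousOn g (Metric.sphere c R))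
    (hs : dist s c < R) : DifferentiableAt ℂ (principalPart g c R) s := by
  lift R to NNReal using dist_nonneg.trans hs.le
  have hR : 0 < R := by exact_mod_cast dist_nonneg.trans_lt hs
  have hball : s ∈ Metric.eball c R := by
    rwa [Metric.eball_coe, Metric.mem_ball]
  have h := ((hasFPowerSeriesOn_cauchy_integral
    (hg.circleIntegrable R.coe_nonneg) hR).differentiableOn.differentiableAt
      (Metric.isOpen_eball.mem_nhds hball)).neg
  exact h.congr_of_eventuallyEq
    (Eventually.of_forall (principalPart_eq_neg_cauchyIntegral g c R))

theorem circleIntegral_dslope (hR : 0 ≤ R) (hg : ContinuousOn g (Metric.sphere c R))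
    (hs : s ∉ Metric.sphere c R) :
    ∮ z in C(c, R), dslope g s z =
      -(2 * Real.pi * I * principalPart g c R s) - g s * ∮ z in C(c, R), (z - s)⁻¹ := by
  have hne : ∀ z ∈ Metric.sphere c R, z ≠ s := fun z hz h => hs (h ▸ hz)
  have hinv : ContinuousOn (fun z => (z - s)⁻¹) (Metric.sphere c R) :=
    (continuousOn_id.sub continuousOn_const).inv₀ fun z hz => sub_ne_zero.2 (hne z hz)
  rw [principalPart_eq_neg_cauchyIntegral, smul_eq_mul, mul_neg, neg_neg,
    mul_inv_cancel_left₀ two_pi_I_ne_zero, ← circleIntegral.integral_const_mul,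
    ← circleIntegral.integral_sub (f := fun z => (z - s)⁻¹ • g z)
      (g := fun z => g s * (z - s)⁻¹) ((hinv.smul hg).circleIntegrable hR)
      ((continuousOn_const.mul hinv).circleIntegrable hR)]
  refine circleIntegral.integral_congr hR fun z hz => ?_
  simp only [dslope_of_ne _ (hne z hz), slope_def_field, smul_eq_mul]
  ring

theorem eq_principalPart_sub_principalPart (hR : 0 < R)
    (hg : ∀ z, R ≤ dist z c → DifferentiableAt ℂ g z) (hs : R < dist s c) (hρ : dist s c < ρ) :
    g s = principalPart g c R s - principalPart g c ρ s := by
  have hdslope : (∮ z in C(c, ρ), dslope g s z) = ∮ z in C(c, R), dslope g s z :=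
    circleIntegral_eq_of_differentiable_on_annulus_off_countable hR (hs.trans hρ).le
      (countable_singleton s)
      (fun z hz => by
        refine ContinuousAt.continuousWithinAt ?_
        rcases eq_or_ne z s with rfl | h
        · exact continuousAt_dslope_same.2 (hg z hs.le)
        · exact (continuousAt_dslope_of_ne h).2 (hg z (by simpa using hz.2)).continuousAt)
      (fun z hz =>
        (differentiableAt_dslope_of_ne hz.2).2 (hg z (le_of_lt (by simpa using hz.1.2))))
  have houter : (∮ z in C(c, ρ), (z - s)⁻¹) = 2 * Real.pi * I :=
    circleIntegral.integral_sub_inv_of_mem_ball hρ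
  have hinner : (∮ z in C(c, R), (z - s)⁻¹) = 0 := by
    have hd : ∀ z ∈ Metric.closedBall c R, DifferentiableAt ℂ (fun z => (z - s)⁻¹) z :=
      fun z hz => (differentiableAt_id.sub_const s).inv
        (sub_ne_zero.2 fun h => hs.not_ge (h ▸ Metric.mem_closedBall.1 hz))
    exact circleIntegral_eq_zero_of_differentiable_on_off_countable hR.le countable_empty
      (fun z hz => (hd z hz).continuousAt.continuousWithinAt)
      (fun z hz => hd z (Metric.ball_subset_closedBall hz.1))
  rw [circleIntegral_dslope hR.le (continuousOn_sphere_of_differentiableAt hg le_rfl) hs.ne',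
    circleIntegral_dslope (hR.trans (hs.trans hρ)).le
      (continuousOn_sphere_of_differentiableAt hg (hs.trans hρ).le) hρ.ne, houter,
    hinner] at hdslope
  exact mul_left_cancel₀ two_pi_I_ne_zero (by linear_combination -hdslope)

theorem exists_entire_add_principalPart (hR : 0 < R)
    (hg : ∀ z, R ≤ dist z c → DifferentiableAt ℂ g z) :
    ∃ E : ℂ → ℂ, Differentiable ℂ E ∧ ∀ s, R < dist s c → g s = E s + principalPart g c R s := by
  -- The entire part at `s` is the Cauchy integral `∮ (w - s)⁻¹ g(w) dw / 2πi` over any circle of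
  -- radius exceeding `dist s c`.
  have hpos : ∀ s, 0 ≤ dist s c := fun s => dist_nonneg
  refine ⟨fun s => -principalPart g c (R + dist s c) s, fun s₀ => ?_, fun s hs => ?_⟩
  · have hlocal : DifferentiableAt ℂ (fun s => -principalPart g c (R + dist s₀ c + 1) s) s₀ :=
      (differentiableAt_principalPart (continuousOn_sphere_of_differentiableAt hg
        (by linarith [hpos s₀])) (by linarith)).neg
    refine hlocal.congr_of_eventuallyEq ?_
    filter_upwards [Metric.ball_mem_nhds s₀ one_pos] with s hs
    have hs : dist s c ≤ dist s₀ c + 1 := by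
      linarith [dist_triangle s s₀ c, Metric.mem_ball.1 hs]
    rw [principalPart_congr_radius (R := R + dist s c) (by linarith [hpos s])
      (ρ := R + dist s₀ c + 1) (fun z hz => hg z (by linarith [hpos s])) (by linarith)
      (by linarith)]
  · rw [eq_principalPart_sub_principalPart hR hg hs (lt_add_of_pos_left _ hR)]
    ring

end PrincipalPart

section CircleFubini

variable {K : ℝ → ℂ → ℂ} {A : Set ℝ} {D : ℝ → ℝ} {c : ℂ} {R : ℝ}

theorem integrable_prod_circle (hA : MeasurableSet A) (hR : 0 ≤ R)
    (hK : ContinuousOn K.uncurry (A ×ˢ Metric.sphere c R)) (hD : IntegrableOn D A)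
    (hKD : ∀ x ∈ A, ∀ w ∈ Metric.sphere c R, ‖K x w‖ ≤ D x) :
    Integrable (fun θ x => deriv (circleMap c R) θ • K x (circleMap c R θ)).uncurry
      ((volume.restrict (uIoc 0 (2 * Real.pi))).prod (volume.restrict A)) := by
  have hm : ∀ θ, circleMap c R θ ∈ Metric.sphere c R := circleMap_mem_sphere c hR
  have : IsFiniteMeasure (volume.restrict (uIoc 0 (2 * Real.pi))) := by
    rw [uIoc_of_le Real.two_pi_pos.le]
    infer_instance
  have hcont : ContinuousOn (fun θ x => deriv (circleMap c R) θ • K x (circleMap c R θ)).uncurry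
      (uIoc 0 (2 * Real.pi) ×ˢ A) := by
    simp only [deriv_circleMap]
    exact (((continuous_circleMap 0 R).comp continuous_fst).mul continuous_const).continuousOn.smul
      (hK.comp (continuous_snd.prodMk ((continuous_circleMap c R).comp
        continuous_fst)).continuousOn fun p hp => ⟨hp.2, hm p.1⟩)
  refine ((Integrable.comp_snd (f := D) hD _).const_mul R).mono' ?_ ?_ <;>
    rw [Measure.prod_restrict]
  · exact hcont.aestronglyMeasurable (measurableSet_uIoc.prod hA)
  · refine (ae_restrict_iff' (measurableSet_uIoc.prod hA)).2 (Eventually.of_forall ?_)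
    rintro ⟨θ, x⟩ hp
    rw [Function.uncurry_apply_pair, norm_smul, deriv_circleMap, norm_mul, norm_circleMap_zero,
      norm_I, mul_one, abs_of_nonneg hR]
    exact mul_le_mul_of_nonneg_left (hKD x hp.2 _ (hm θ)) hR

theorem integrableOn_circleIntegral (hA : MeasurableSet A) (hR : 0 ≤ R)
    (hK : ContinuousOn K.uncurry (A ×ˢ Metric.sphere c R)) (hD : IntegrableOn D A)
    (hKD : ∀ x ∈ A, ∀ w ∈ Metric.sphere c R, ‖K x w‖ ≤ D x) :
    IntegrableOn (fun x => ∮ w in C(c, R), K x w) A := by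
  simp only [circleIntegral, intervalIntegral.integral_of_le Real.two_pi_pos.le,
    ← uIoc_of_le Real.two_pi_pos.le]
  exact (integrable_prod_circle hA hR hK hD hKD).integral_prod_right

theorem integral_circleIntegral_swap (hA : MeasurableSet A) (hR : 0 ≤ R)
    (hK : ContinuousOn K.uncurry (A ×ˢ Metric.sphere c R)) (hD : IntegrableOn D A)
    (hKD : ∀ x ∈ A, ∀ w ∈ Metric.sphere c R, ‖K x w‖ ≤ D x) :
    ∫ x in A, ∮ w in C(c, R), K x w = ∮ w in C(c, R), ∫ x in A, K x w := by
  simp only [circleIntegral, ← integral_smul]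
  exact (intervalIntegral_integral_swap (integrable_prod_circle hA hR hK hD hKD)).symm

end CircleFubini

section LineShift

variable {f : ℂ → ℂ} {a b R : ℝ} {c w : ℂ}

theorem one_add_sq_le_mul_sq_norm {p d : ℝ} (hd : 0 < d) (hp : d ≤ |p|) (v y : ℝ) :
    1 + y ^ 2 ≤ ((1 + 2 * v ^ 2) / d ^ 2 + 2) * ‖(p : ℂ) + (y - v : ℝ) * I‖ ^ 2 := by
  have hp2 : d ^ 2 ≤ p ^ 2 := by rw [← sq_abs p]; gcongr
  rw [Complex.sq_norm, normSq_add_mul_I]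
  calc 1 + y ^ 2 ≤ (1 + 2 * v ^ 2) / d ^ 2 * d ^ 2 + 2 * (y - v) ^ 2 := by
        rw [div_mul_cancel₀ _ (by positivity)]
        nlinarith [sq_nonneg (y - 2 * v)]
    _ ≤ (1 + 2 * v ^ 2) / d ^ 2 * (p ^ 2 + (y - v) ^ 2) + 2 * (p ^ 2 + (y - v) ^ 2) := by
        gcongr <;> nlinarith
    _ = _ := by ring

theorem norm_inv_sub_inv_vertical_le (ha : a < w.re) (hb : w.re < b) (y : ℝ) :
    ‖((b : ℂ) + y * I - w)⁻¹ - ((a : ℂ) + y * I - w)⁻¹‖ ≤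
      (b - a) * ((1 + 2 * w.im ^ 2) / min (b - w.re) (w.re - a) ^ 2 + 2) * (1 + y ^ 2)⁻¹ := by
  set d := min (b - w.re) (w.re - a)
  have hd : 0 < d := lt_min (sub_pos.2 hb) (sub_pos.2 ha)
  have hline : ∀ κ : ℝ, (κ : ℂ) + y * I - w = (κ - w.re : ℝ) + (y - w.im : ℝ) * I := fun κ => by
    apply Complex.ext <;> simp
  have hbound : ∀ κ : ℝ, d ≤ |κ - w.re| →
      1 + y ^ 2 ≤ ((1 + 2 * w.im ^ 2) / d ^ 2 + 2) * ‖(κ : ℂ) + y * I - w‖ ^ 2 := fun κ hκ => by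
    rw [hline κ]
    exact one_add_sq_le_mul_sq_norm hd hκ w.im y
  have hbd := hbound b ((min_le_left _ _).trans (le_abs_self _))
  have had := hbound a ((min_le_right _ _).trans ((neg_sub a w.re).symm.trans_le (neg_le_abs _)))
  have hpos : ∀ {z : ℂ} {C : ℝ}, 1 + y ^ 2 ≤ C * ‖z‖ ^ 2 → 0 < ‖z‖ := fun {z C} h => by
    refine (norm_nonneg z).lt_of_ne fun h0 => ?_
    rw [← h0] at h
    nlinarith
  have hdiff : ‖(a : ℂ) + y * I - w - (b + y * I - w)‖ = b - a := by
    rw [sub_sub_sub_cancel_right, add_sub_add_right_eq_sub, ← ofReal_sub, norm_real,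
      Real.norm_eq_abs, abs_sub_comm, abs_of_pos (sub_pos.2 (ha.trans hb))]
  rw [inv_sub_inv (norm_pos_iff.1 (hpos hbd)) (norm_pos_iff.1 (hpos had)), norm_div, norm_mul,
    hdiff, mul_assoc, div_eq_mul_inv]
  refine mul_le_mul_of_nonneg_left ?_ (sub_pos.2 (ha.trans hb)).le
  rw [← div_eq_mul_inv, le_div_iff₀ (by positivity),
    inv_mul_le_iff₀ (mul_pos (hpos hbd) (hpos had))]
  refine (sq_le_sq₀ (by positivity) (by positivity)).1 ?_
  nlinarith [mul_le_mul had hbd (by positivity) (by positivity)]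

theorem integrable_inv_sub_inv_vertical (ha : a < w.re) (hb : w.re < b) :
    Integrable fun y : ℝ => ((b : ℂ) + y * I - w)⁻¹ - ((a : ℂ) + y * I - w)⁻¹ := by
  have hne : ∀ κ : ℝ, κ ≠ w.re → ∀ y : ℝ, (κ : ℂ) + y * I - w ≠ 0 := fun κ hκ y h =>
    hκ (by simpa [sub_eq_zero] using congrArg re h)
  have hcont : Continuous fun y : ℝ => ((b : ℂ) + y * I - w)⁻¹ - ((a : ℂ) + y * I - w)⁻¹ :=
    (Continuous.inv₀ (by fun_prop) (hne b hb.ne')).sub (Continuous.inv₀ (by fun_prop) (hne a ha.ne))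
  exact (integrable_inv_one_add_sq.const_mul _).mono' hcont.aestronglyMeasurable
    (Eventually.of_forall (norm_inv_sub_inv_vertical_le ha hb))

theorem integral_univ_div_sq_add_sq {p : ℝ} (hp : 0 < p) :
    ∫ y : ℝ, p / (p ^ 2 + y ^ 2) = Real.pi := by
  have hscale : ∀ y : ℝ, p / (p ^ 2 + y ^ 2) = p⁻¹ * (1 + (y / p) ^ 2)⁻¹ := fun y => by
    field_simp
  simp only [hscale]
  rw [integral_const_mul, Measure.integral_comp_div (fun y => (1 + y ^ 2)⁻¹) p,
    integral_univ_inv_one_add_sq, abs_of_pos hp, smul_eq_mul, inv_mul_cancel_left₀ hp.ne']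

theorem integrable_div_sq_add_sq {p : ℝ} (hp : 0 < p) :
    Integrable fun y : ℝ => p / (p ^ 2 + y ^ 2) :=
  .of_integral_ne_zero (by rw [integral_univ_div_sq_add_sq hp]; exact Real.pi_ne_zero)

theorem inv_add_mul_I_add_inv_sub_mul_I {p : ℝ} (hp : p ≠ 0) (y : ℝ) :
    ((p : ℂ) + y * I)⁻¹ + ((p : ℂ) - y * I)⁻¹ = 2 * (p / (p ^ 2 + y ^ 2) : ℝ) := by
  have hne : ∀ y : ℝ, (p : ℂ) + y * I ≠ 0 := fun y h => hp (by simpa using congrArg re h)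
  have hprod : ((p : ℂ) + y * I) * (p - y * I) = (p ^ 2 + y ^ 2 : ℝ) := by
    push_cast
    linear_combination -(y : ℂ) ^ 2 * I_sq
  have hne' : (p : ℂ) - y * I ≠ 0 := by simpa [sub_eq_add_neg] using hne (-y)
  rw [inv_add_inv (hne y) hne', hprod]
  push_cast
  ring

theorem integral_inv_sub_inv_vertical (ha : a < w.re) (hb : w.re < b) :
    ∫ y : ℝ, (((b : ℂ) + y * I - w)⁻¹ - ((a : ℂ) + y * I - w)⁻¹) = 2 * Real.pi := by
  obtain ⟨p, hp⟩ : ∃ p, p = b - w.re := ⟨_, rfl⟩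
  obtain ⟨q, hq⟩ : ∃ q, q = w.re - a := ⟨_, rfl⟩
  set k : ℝ → ℂ := fun y => ((p : ℂ) + y * I)⁻¹ + ((q : ℂ) - y * I)⁻¹ with hk
  have hp0 : 0 < p := by linarith
  have hq0 : 0 < q := by linarith
  have htranslate : (fun y : ℝ => ((b : ℂ) + y * I - w)⁻¹ - ((a : ℂ) + y * I - w)⁻¹) =
      fun y => k (y - w.im) := by
    funext y
    have hpw : (b : ℂ) + y * I - w = p + (y - w.im : ℝ) * I := by apply Complex.ext <;> simp [hp]
    have hqw : (a : ℂ) + y * I - w = -(q - (y - w.im : ℝ) * I) := by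
      apply Complex.ext <;> simp [hq]
    rw [hk, hpw, hqw, inv_neg, sub_neg_eq_add]
  have hint : Integrable k := by
    have htr := integrable_inv_sub_inv_vertical ha hb
    rw [htranslate] at htr
    simpa using htr.comp_add_right w.im
  -- Adding the reflection `y ↦ -y` turns the integrand into a sum of Poisson kernels.
  have hsymm : ∀ y : ℝ, k y + k (-y) =
      2 * (p / (p ^ 2 + y ^ 2) : ℝ) + 2 * (q / (q ^ 2 + y ^ 2) : ℝ) := fun y => by
    rw [← inv_add_mul_I_add_inv_sub_mul_I hp0.ne', ← inv_add_mul_I_add_inv_sub_mul_I hq0.ne', hk]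
    push_cast
    ring_nf
  have htwice : (∫ y, k y) + ∫ y, k (-y) = 2 * Real.pi + 2 * Real.pi := by
    rw [← integral_add hint hint.comp_neg]
    simp only [hsymm]
    rw [integral_add ((integrable_div_sq_add_sq hp0).ofReal.const_mul 2)
      ((integrable_div_sq_add_sq hq0).ofReal.const_mul 2), integral_const_mul, integral_const_mul,
      integral_complex_ofReal, integral_complex_ofReal, integral_univ_div_sq_add_sq hp0,
      integral_univ_div_sq_add_sq hq0]
  rw [integral_neg_eq_self k volume] at htwice
  rw [htranslate, integral_sub_right_eq_self k]
  linear_combination htwice / 2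

theorem continuousOn_inv_sub_inv_vertical {s : Set ℂ} (hs : ∀ w ∈ s, a < w.re ∧ w.re < b) :
    ContinuousOn (fun p : ℝ × ℂ => ((b : ℂ) + p.1 * I - p.2)⁻¹ - ((a : ℂ) + p.1 * I - p.2)⁻¹)
      (univ ×ˢ s) := by
  have hκ : ∀ κ : ℝ, (∀ w ∈ s, κ ≠ w.re) →
      ContinuousOn (fun p : ℝ × ℂ => ((κ : ℂ) + p.1 * I - p.2)⁻¹) (univ ×ˢ s) := fun κ hκ =>
    ContinuousOn.inv₀ (by fun_prop) fun p hp h => hκ _ hp.2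
      (by simpa [sub_eq_zero] using congrArg re h)
  exact (hκ b fun w hw => (hs w hw).2.ne').sub (hκ a fun w hw => (hs w hw).1.ne)

theorem exists_norm_inv_sub_inv_vertical_mul_le {s : Set ℂ} (hs : IsCompact s)
    (hsab : ∀ w ∈ s, a < w.re ∧ w.re < b) (hf : ContinuousOn f s) :
    ∃ M : ℝ, ∀ w ∈ s, ∀ y : ℝ,
      ‖(((b : ℂ) + y * I - w)⁻¹ - ((a : ℂ) + y * I - w)⁻¹) * f w‖ ≤ M * (1 + y ^ 2)⁻¹ := by
  set C : ℂ → ℝ := fun w =>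
    (b - a) * ((1 + 2 * w.im ^ 2) / min (b - w.re) (w.re - a) ^ 2 + 2)
  have hCcont : ContinuousOn C s :=
    continuousOn_const.mul ((ContinuousOn.div (by fun_prop) (by fun_prop) fun w hw =>
      (pow_pos (lt_min (sub_pos.2 (hsab w hw).2) (sub_pos.2 (hsab w hw).1)) 2).ne').add
        continuousOn_const)
  obtain ⟨M, hM⟩ := hs.exists_bound_of_continuousOn (hCcont.mul hf.norm)
  refine ⟨M, fun w hw y => ?_⟩
  rw [norm_mul]
  calc _ ≤ C w * (1 + y ^ 2)⁻¹ * ‖f w‖ := by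
        gcongr
        exact norm_inv_sub_inv_vertical_le (hsab w hw).1 (hsab w hw).2 y
    _ = C w * ‖f w‖ * (1 + y ^ 2)⁻¹ := by ring
    _ ≤ M * (1 + y ^ 2)⁻¹ := by
        gcongr
        exact (le_abs_self _).trans (hM w hw)

theorem principalPart_vertical_sub (hR : 0 ≤ R) (hf : ContinuousOn f (Metric.sphere c R))
    (hab : ∀ w ∈ Metric.sphere c R, a < w.re ∧ w.re < b) :
    Integrable (fun y : ℝ => principalPart f c R (b + y * I) - principalPart f c R (a + y * I)) ∧
      I * ∫ y : ℝ, (principalPart f c R (b + y * I) - principalPart f c R (a + y * I)) =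
        ∮ w in C(c, R), f w := by
  obtain ⟨M, hM⟩ := exists_norm_inv_sub_inv_vertical_mul_le (isCompact_sphere c R) hab hf
  have hD := (integrable_inv_one_add_sq.const_mul M).integrableOn (s := univ)
  have hKM := fun (y : ℝ) (_ : y ∈ univ) w hw => hM w hw y
  have hK : ContinuousOn (fun (y : ℝ) (w : ℂ) =>
      (((b : ℂ) + y * I - w)⁻¹ - ((a : ℂ) + y * I - w)⁻¹) * f w).uncurry
      (univ ×ˢ Metric.sphere c R) :=
    (continuousOn_inv_sub_inv_vertical hab).mul (hf.comp continuousOn_snd fun p hp => hp.2)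
  have hline : ∀ κ : ℝ, (∀ w ∈ Metric.sphere c R, κ ≠ w.re) → ∀ y : ℝ,
      CircleIntegrable (fun w => ((κ : ℂ) + y * I - w)⁻¹ * f w) c R := fun κ hκ y =>
    ContinuousOn.circleIntegrable hR (ContinuousOn.mul (ContinuousOn.inv₀ (by fun_prop)
      fun w hw h => hκ w hw (by simpa [sub_eq_zero] using congrArg re h)) hf)
  have hsub : ∀ y : ℝ, principalPart f c R (b + y * I) - principalPart f c R (a + y * I) =
      (2 * Real.pi * I : ℂ)⁻¹ *
        ∮ w in C(c, R), (((b : ℂ) + y * I - w)⁻¹ - ((a : ℂ) + y * I - w)⁻¹) * f w := fun y => by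
    rw [principalPart, principalPart, ← mul_sub, ← circleIntegral.integral_sub
      (hline b (fun w hw => (hab w hw).2.ne') y) (hline a (fun w hw => (hab w hw).1.ne) y)]
    simp only [sub_mul]
  simp only [hsub]
  refine ⟨(integrableOn_univ.1 (integrableOn_circleIntegral .univ hR hK hD hKM)).const_mul _, ?_⟩
  have hswap := integral_circleIntegral_swap .univ hR hK hD hKM
  rw [setIntegral_univ] at hswap
  rw [integral_const_mul, hswap, circleIntegral.integral_congr (g := fun w => 2 * Real.pi * f w) hR
    fun w hw => by simp only [setIntegral_univ, integral_mul_const,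
      integral_inv_sub_inv_vertical (hab w hw).1 (hab w hw).2], circleIntegral.integral_const_mul]
  field_simp

theorem abs_re_sub_re_le_dist (z w : ℂ) : |z.re - w.re| ≤ dist z w := by
  rw [dist_eq, ← sub_re]
  exact abs_re_le_norm _

theorem integral_vertical_sub_eq_circleIntegral (hR : 0 < R)
    (hf : ∀ z, R ≤ dist z c → DifferentiableAt ℂ f z) (ha : a < c.re - R) (hb : c.re + R < b)
    (hlim : Tendsto f (stripAtInfty a b) (𝓝 0))
    (hint : Integrable fun y : ℝ => f (b + y * I) - f (a + y * I)) :
    I * ∫ y : ℝ, (f (b + y * I) - f (a + y * I)) = ∮ w in C(c, R), f w := by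
  have hsphere : ∀ w ∈ Metric.sphere c R, a < w.re ∧ w.re < b := fun w hw => by
    have := abs_le.1 ((abs_re_sub_re_le_dist w c).trans (Metric.mem_sphere.1 hw).le)
    constructor <;> linarith
  have hfR := continuousOn_sphere_of_differentiableAt hf le_rfl
  obtain ⟨E, hE, hfE⟩ := exists_entire_add_principalPart hR hf
  obtain ⟨hPint, hPcircle⟩ := principalPart_vertical_sub hR.le hfR hsphere
  have hlines : ∀ y : ℝ, f (b + y * I) - f (a + y * I) = (E (b + y * I) - E (a + y * I)) +
      (principalPart f c R (b + y * I) - principalPart f c R (a + y * I)) := fun y => by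
    have hfar : ∀ κ : ℝ, R < |κ - c.re| → R < dist ((κ : ℂ) + y * I) c := fun κ hκ =>
      hκ.trans_le (by simpa using abs_re_sub_re_le_dist ((κ : ℂ) + y * I) c)
    rw [hfE _ (hfar b (lt_abs.2 (.inl (by linarith)))),
      hfE _ (hfar a (lt_abs.2 (.inr (by linarith))))]
    ring
  have hElim : Tendsto E (stripAtInfty a b) (𝓝 0) := by
    have hsub := hlim.sub ((tendsto_principalPart hR.le hfR).mono_left
      (stripAtInfty_le_cobounded a b))
    rw [sub_zero] at hsub
    refine hsub.congr' ?_
    filter_upwards [stripAtInfty_le_cobounded a b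
      ((Metric.tendsto_dist_right_cobounded_atTop c).eventually_gt_atTop R)] with s hs
    rw [hfE s hs, add_sub_cancel_right]
  have hEint : Integrable fun y : ℝ => E (b + y * I) - E (a + y * I) :=
    (hint.sub hPint).congr (Eventually.of_forall fun y => by simp [hlines])
  have hE0 := integral_vertical_sub_eq_zero (by linarith) (fun z _ _ => hE z) hElim hEint
  simp only [hlines]
  rw [integral_add hEint hPint, hE0, zero_add, hPcircle]

theorem mellinInv_sub_mellinInv_eq_residualIntegral {x : ℝ} (hx : 0 < x) (hR : 0 < R)
    (hf : ∀ z, R ≤ dist z c → DifferentiableAt ℂ f z) (ha : a < c.re - R) (hb : c.re + R < b)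
    (hO : f =O[stripAtInfty a b] fun s => (s ^ 2)⁻¹) :
    mellinInv b f x - mellinInv a f x = residualIntegral f c R x := by
  have hint : ∀ κ ∈ Icc a b, R < |κ - c.re| →
      VerticalIntegrable (fun s => (x : ℂ) ^ (-s) * f s) κ := fun κ hκ hκc =>
    verticalIntegrable_cpow_neg_mul hx <| verticalIntegrable_of_isBigO_inv_sq
      (fun z hz => hf z (hκc.le.trans (hz ▸ abs_re_sub_re_le_dist z c)))
      (hO.mono (stripAtInfty_mono hκ.1 hκ.2))
  have ha' := hint a ⟨le_rfl, by linarith⟩ (lt_abs.2 (.inr (by linarith)))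
  have hb' := hint b ⟨by linarith, le_rfl⟩ (lt_abs.2 (.inl (by linarith)))
  have hcircle := integral_vertical_sub_eq_circleIntegral hR (f := fun s => (x : ℂ) ^ (-s) * f s)
    (fun z hz => (differentiable_ofReal_cpow_neg hx z).mul (hf z hz)) ha hb
    ((isBigO_ofReal_cpow_neg_mul hx hO).trans_tendsto (tendsto_inv_sq_stripAtInfty a b))
    (hb'.sub ha')
  rw [mellinInv_sub_mellinInv ha' hb', hcircle, residualIntegral]
  simp only [mul_comm]

end LineShift

section PhragmenLindelof

variable {g : ℂ → ℂ} {a b k A R θ : ℝ} {c : ℂ}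

theorem exists_bound_of_isBigO_cobounded_inf_principal {s : Set ℂ} (hg : Continuous g)
    (hO : g =O[Bornology.cobounded ℂ ⊓ 𝓟 s] fun _ => (1 : ℝ)) : ∃ M, ∀ z ∈ s, ‖g z‖ ≤ M := by
  obtain ⟨C, hC⟩ := hO.bound
  have hfar : ∀ᶠ z in comap norm atTop, z ∈ s → ‖g z‖ ≤ C := by
    simpa [comap_norm_atTop] using eventually_inf_principal.1 hC
  obtain ⟨r, hr⟩ := eventually_atTop.1 (eventually_comap.1 hfar)
  obtain ⟨C', hC'⟩ := (isCompact_closedBall (0 : ℂ) r).exists_bound_of_continuousOn hg.continuousOn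
  refine ⟨max C C', fun z hz => ?_⟩
  rcases le_total r ‖z‖ with h | h
  · exact (hr _ h z rfl hz).trans (le_max_left _ _)
  · exact (hC' z (mem_closedBall_zero_iff.2 h)).trans (le_max_right _ _)

theorem comap_abs_im_inf_principal_le_stripAtInfty (a b : ℝ) :
    comap (abs ∘ im) atTop ⊓ 𝓟 (re ⁻¹' Ioo a b) ≤ stripAtInfty a b := by
  refine inf_le_inf ?_ (principal_mono.2 fun z hz => ⟨hz.1.le, hz.2.le⟩)
  rw [← comap_norm_atTop, ← tendsto_iff_comap]
  exact tendsto_atTop_mono abs_im_le_norm tendsto_comap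

theorem isBigO_one_of_differentiable (hg : Differentiable ℂ g) (hk0 : 0 ≤ k) (hA : 0 ≤ A)
    (hk : k < Real.pi / (b - a))
    (hO : g =O[stripAtInfty a b] fun s => Real.exp (A * Real.exp (k * ‖s‖)))
    (ha : g =O[stripAtInfty a a] fun _ => (1 : ℝ)) (hb : g =O[stripAtInfty b b] fun _ => (1 : ℝ)) :
    g =O[stripAtInfty a b] fun _ => (1 : ℝ) := by
  obtain ⟨Ma, hMa⟩ := exists_bound_of_isBigO_cobounded_inf_principal hg.continuous ha
  obtain ⟨Mb, hMb⟩ := exists_bound_of_isBigO_cobounded_inf_principal hg.continuous hb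
  have hnorm : ∀ z ∈ re ⁻¹' Ioo a b, ‖z‖ ≤ |a| + |b| + |z.im| := fun z hz => by
    linarith [norm_le_abs_re_add_abs_im z, abs_le_max_abs_abs hz.1.le hz.2.le,
      max_le_add_of_nonneg (abs_nonneg a) (abs_nonneg b)]
  have hgrowth : g =O[comap (abs ∘ im) atTop ⊓ 𝓟 (re ⁻¹' Ioo a b)]
      fun z => Real.exp (A * Real.exp (k * (|a| + |b|)) * Real.exp (k * |z.im|)) := by
    refine (hO.mono (comap_abs_im_inf_principal_le_stripAtInfty a b)).trans
      (IsBigO.of_bound 1 ?_)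
    filter_upwards [mem_inf_of_right (mem_principal_self _)] with z hz
    rw [Real.norm_of_nonneg (Real.exp_pos _).le, Real.norm_of_nonneg (Real.exp_pos _).le, one_mul,
      mul_assoc, ← Real.exp_add, ← mul_add]
    gcongr
    exact hnorm z hz
  refine IsBigO.of_bound (max Ma Mb) ?_
  filter_upwards [eventually_mem_strip a b] with z hz
  rw [norm_one, mul_one]
  exact PhragmenLindelof.vertical_strip hg.diffContOnCl ⟨k, hk, _, hgrowth⟩
    (fun z hz => (hMa z ⟨hz.ge, hz.le⟩).trans (le_max_left _ _))
    (fun z hz => (hMb z ⟨hz.ge, hz.le⟩).trans (le_max_right _ _)) hz.1 hz.2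

theorem isBigO_one_of_differentiable_outside_disc (hR : 0 < R)
    (hg : ∀ z, R ≤ dist z c → DifferentiableAt ℂ g z) (hk0 : 0 ≤ k) (hA : 0 ≤ A)
    (hk : k < Real.pi / (b - a))
    (hO : g =O[stripAtInfty a b] fun s => Real.exp (A * Real.exp (k * ‖s‖)))
    (ha : g =O[stripAtInfty a a] fun _ => (1 : ℝ)) (hb : g =O[stripAtInfty b b] fun _ => (1 : ℝ)) :
    g =O[stripAtInfty a b] fun _ => (1 : ℝ) := by
  obtain ⟨E, hE, hgE⟩ := exists_entire_add_principalPart hR hg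
  have hP : principalPart g c R =O[Bornology.cobounded ℂ] fun _ => (1 : ℝ) :=
    (tendsto_principalPart hR.le (continuousOn_sphere_of_differentiableAt hg le_rfl)).isBigO_one ℝ
  have hPstrip : ∀ p q, principalPart g c R =O[stripAtInfty p q] fun _ => (1 : ℝ) := fun p q =>
    hP.mono (stripAtInfty_le_cobounded p q)
  have hgE' : ∀ p q, g =ᶠ[stripAtInfty p q] fun s => E s + principalPart g c R s := fun p q =>
    ((Metric.tendsto_dist_right_cobounded_atTop c).eventually_gt_atTop R).filter_mono
      (stripAtInfty_le_cobounded p q) |>.mono hgE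
  have hEg : ∀ p q, E =ᶠ[stripAtInfty p q] fun s => g s - principalPart g c R s := fun p q =>
    (hgE' p q).mono fun s hs => (sub_eq_of_eq_add hs).symm
  have hone : (fun _ => (1 : ℝ)) =O[stripAtInfty a b]
      fun s => Real.exp (A * Real.exp (k * ‖s‖)) := by
    refine IsBigO.of_bound 1 (Eventually.of_forall fun s => ?_)
    rw [norm_one, one_mul, Real.norm_of_nonneg (Real.exp_pos _).le]
    exact Real.one_le_exp (by positivity)
  have hEO := isBigO_one_of_differentiable hE hk0 hA hk
    ((hEg a b).trans_isBigO (hO.sub ((hPstrip a b).trans hone)))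
    ((hEg a a).trans_isBigO (ha.sub (hPstrip a a)))
    ((hEg b b).trans_isBigO (hb.sub (hPstrip b b)))
  exact (hgE' a b).trans_isBigO (hEO.add (hPstrip a b))

theorem sq_isBigO_exp_exp (hk : 0 < k) :
    (fun s : ℂ => s ^ 2) =O[Bornology.cobounded ℂ] fun s => Real.exp (Real.exp (k * ‖s‖)) := by
  have hpow : (fun s : ℂ => s ^ 2) =O[Bornology.cobounded ℂ] fun s => Real.exp (k * ‖s‖) :=
    IsBigO.of_norm_left <| by
      simpa only [norm_pow, Function.comp_def] using
        ((isLittleO_pow_exp_pos_mul_atTop 2 hk).comp_tendsto tendsto_norm_cobounded_atTop).isBigO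
  refine hpow.trans (IsBigO.of_bound 1 (Eventually.of_forall fun s => ?_))
  rw [Real.norm_of_nonneg (Real.exp_pos _).le, Real.norm_of_nonneg (Real.exp_pos _).le, one_mul]
  linarith [Real.add_one_le_exp (Real.exp (k * ‖s‖))]

theorem isBigO_inv_sq_of_isBigO_exp_exp (hab : a < b) (hR : 0 < R)
    (hg : ∀ z, R ≤ dist z c → DifferentiableAt ℂ g z) (hθ : θ < 1)
    (hO : g =O[stripAtInfty a b] fun s => Real.exp (Real.exp (θ * Real.pi * ‖s‖ / (b - a))))
    (ha : g =O[stripAtInfty a a] fun s => (s ^ 2)⁻¹)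
    (hb : g =O[stripAtInfty b b] fun s => (s ^ 2)⁻¹) :
    g =O[stripAtInfty a b] fun s => (s ^ 2)⁻¹ := by
  have hba : 0 < Real.pi / (b - a) := div_pos Real.pi_pos (sub_pos.2 hab)
  obtain ⟨k, hθk, hk⟩ : ∃ k, max (θ * (Real.pi / (b - a))) 0 < k ∧ k < Real.pi / (b - a) :=
    exists_between (max_lt (mul_lt_of_lt_one_left hba hθ) hba)
  have hk0 : 0 < k := (le_max_right _ _).trans_lt hθk
  have hne : ∀ p q, ∀ᶠ s in stripAtInfty p q, s ^ 2 ≠ 0 := fun p q =>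
    ((Bornology.eventually_ne_cobounded 0).filter_mono (stripAtInfty_le_cobounded p q)).mono
      fun s hs => pow_ne_zero 2 hs
  have hline : ∀ {p q}, g =O[stripAtInfty p q] (fun s => (s ^ 2)⁻¹) →
      (fun s => s ^ 2 * g s) =O[stripAtInfty p q] fun _ => (1 : ℝ) := fun {p q} h =>
    ((isBigO_refl _ _).mul h).trans <| IsBigO.of_bound 1 <| (hne p q).mono fun s hs => by
      rw [mul_inv_cancel₀ hs, norm_one, norm_one, one_mul]
  have hgk : g =O[stripAtInfty a b] fun s => Real.exp (Real.exp (k * ‖s‖)) := by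
    refine hO.trans (IsBigO.of_bound 1 (Eventually.of_forall fun s => ?_))
    rw [Real.norm_of_nonneg (Real.exp_pos _).le, Real.norm_of_nonneg (Real.exp_pos _).le, one_mul,
      mul_assoc, mul_div_assoc, mul_div_right_comm, ← mul_assoc]
    gcongr
    exact (le_max_left _ _).trans hθk.le
  have hsq : (fun s => s ^ 2 * g s) =O[stripAtInfty a b]
      fun s => Real.exp (2 * Real.exp (k * ‖s‖)) := by
    simpa only [two_mul, Real.exp_add] using
      ((sq_isBigO_exp_exp hk0).mono (stripAtInfty_le_cobounded a b)).mul hgk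
  have hbdd : (fun s => s ^ 2 * g s) =O[stripAtInfty a b] fun _ => (1 : ℂ) :=
    (isBigO_one_of_differentiable_outside_disc hR
      (fun z hz => (differentiableAt_id.pow 2).mul (hg z hz)) hk0.le zero_le_two hk hsq
      (hline ha) (hline hb)).trans (isBigO_const_const _ one_ne_zero _)
  refine ((isBigO_refl (fun s : ℂ => (s ^ 2)⁻¹) _).mul hbdd).congr' ?_ ?_
  · exact (hne a b).mono fun s hs => inv_mul_cancel_left₀ hs (g s)
  · exact Eventually.of_forall fun s => mul_one _

end PhragmenLindelof

section GammaFactor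

variable {r : ℕ} {α : Fin r → ℝ} {β : Fin r → ℂ} {p q : ℝ}

theorem norm_Gamma_le_Gamma_re {z : ℂ} (hz : 0 < z.re) : ‖Complex.Gamma z‖ ≤ Real.Gamma z.re := by
  rw [Complex.Gamma_eq_integral hz, Real.Gamma_eq_integral hz, GammaIntegral]
  refine (norm_integral_le_integral_norm _).trans_eq ?_
  refine setIntegral_congr_fun measurableSet_Ioi fun x hx => ?_
  rw [norm_mul, norm_cpow_eq_rpow_re_of_pos hx, sub_re, one_re, norm_real,
    Real.norm_of_nonneg (Real.exp_pos _).le]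

theorem norm_pow_mul_norm_Gamma_le (N : ℕ) {z : ℂ} (hz : 0 < z.re) :
    ‖z‖ ^ N * ‖Complex.Gamma z‖ ≤ Real.Gamma (z.re + N) := by
  induction N generalizing z with
  | zero => simpa using norm_Gamma_le_Gamma_re hz
  | succ N ih =>
    have hz0 : z ≠ 0 := fun h => hz.ne' (by rw [h, zero_re])
    have hz1 : ‖z‖ ≤ ‖z + 1‖ := by
      rw [← sq_le_sq₀ (norm_nonneg _) (norm_nonneg _), Complex.sq_norm, Complex.sq_norm,
        normSq_add, normSq_one]
      simp only [map_one, mul_one]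
      linarith
    calc ‖z‖ ^ (N + 1) * ‖Complex.Gamma z‖ = ‖z‖ ^ N * ‖Complex.Gamma (z + 1)‖ := by
          rw [Complex.Gamma_add_one z hz0, norm_mul]
          ring
      _ ≤ ‖z + 1‖ ^ N * ‖Complex.Gamma (z + 1)‖ := by gcongr
      _ ≤ Real.Gamma ((z + 1).re + N) := ih (by rw [add_re, one_re]; linarith)
      _ = _ := by
          rw [add_re, one_re]
          push_cast
          ring_nf

theorem Gamma_isBigO_inv_sq (hp : 0 < p) (q : ℝ) :
    Complex.Gamma =O[stripAtInfty p q] fun s => (s ^ 2)⁻¹ := by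
  have hcont : ContinuousOn Real.Gamma (Icc (p + 2) (q + 2)) :=
    Real.differentiableOn_Gamma_Ioi.continuousOn.mono fun x hx => lt_of_lt_of_le (by linarith) hx.1
  obtain ⟨C, hC⟩ := isCompact_Icc.exists_bound_of_continuousOn hcont
  refine IsBigO.of_bound C ?_
  filter_upwards [eventually_mem_strip p q] with z hz
  have hzre := hp.trans_le hz.1
  have hz0 : 0 < ‖z‖ := norm_pos_iff.2 fun h => hzre.ne' (by rw [h, zero_re])
  rw [norm_inv, norm_pow, ← div_eq_mul_inv, le_div_iff₀ (by positivity), mul_comm]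
  exact (norm_pow_mul_norm_Gamma_le 2 hzre).trans ((le_abs_self _).trans
    (hC _ ⟨by push_cast; linarith [hz.1], by push_cast; linarith [hz.2]⟩))

theorem tendsto_affine_cobounded {z : ℂ} (hz : z ≠ 0) (w : ℂ) :
    Tendsto (fun s => z * s + w) (Bornology.cobounded ℂ) (Bornology.cobounded ℂ) :=
  (tendsto_add_const_cobounded w).comp (tendsto_mul_left_cobounded hz)

theorem inv_sq_affine_isBigO {z : ℂ} (hz : z ≠ 0) (w : ℂ) :
    (fun s => ((z * s + w) ^ 2)⁻¹) =O[Bornology.cobounded ℂ] fun s => (s ^ 2)⁻¹ := by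
  have hw : (fun _ : ℂ => w) =o[Bornology.cobounded ℂ] fun s => z * s :=
    isLittleO_const_left.2 <| .inr <|
      tendsto_norm_atTop_iff_cobounded.2 (tendsto_mul_left_cobounded hz)
  have hlin : (fun s : ℂ => s) =O[Bornology.cobounded ℂ] fun s => z * s + w :=
    (isBigO_self_const_mul hz _ _).trans hw.right_isBigO_add'
  refine (hlin.pow 2).inv_rev ?_
  filter_upwards [Bornology.eventually_ne_cobounded 0] with s hs h
  exact absurd h (pow_ne_zero 2 hs)

theorem Gamma_affine_isBigO_inv_sq {x : ℝ} (hx : 0 < x) {w : ℂ} (hp : 0 < x * p + w.re) (q : ℝ) :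
    (fun s => Complex.Gamma (x * s + w)) =O[stripAtInfty p q] fun s => (s ^ 2)⁻¹ := by
  have hx0 : (x : ℂ) ≠ 0 := ofReal_ne_zero.2 hx.ne'
  have hstrip : Tendsto (fun s : ℂ => x * s + w) (stripAtInfty p q)
      (stripAtInfty (x * p + w.re) (x * q + w.re)) := by
    refine tendsto_inf.2 ⟨(tendsto_affine_cobounded hx0 w).mono_left
      (stripAtInfty_le_cobounded p q), tendsto_principal.2 ?_⟩
    filter_upwards [eventually_mem_strip p q] with s hs
    simp only [add_re, re_ofReal_mul]
    exact ⟨by gcongr; exact hs.1, by gcongr; exact hs.2⟩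
  exact ((Gamma_isBigO_inv_sq hp _).comp_tendsto hstrip).trans
    ((inv_sq_affine_isBigO hx0 w).mono (stripAtInfty_le_cobounded p q))

theorem gammaFactor_isBigO_inv_sq (hr : 0 < r) (hα : ∀ i, 0 < α i)
    (hp : ∀ i, 0 < α i * p + (β i).re) (q : ℝ) :
    gammaFactor α β =O[stripAtInfty p q] fun s => (s ^ 2)⁻¹ := by
  have hprod := IsBigO.finsetProd (s := Finset.univ) fun i _ =>
    Gamma_affine_isBigO_inv_sq (hα i) (hp i) q
  obtain ⟨n, rfl⟩ := Nat.exists_eq_succ_of_ne_zero hr.ne'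
  have hpow := (isBigO_refl (fun s : ℂ => (s ^ 2)⁻¹) (stripAtInfty p q)).mul
    (((tendsto_inv_sq_stripAtInfty p q).isBigO_one ℂ).pow n)
  simp only [← pow_succ', one_pow, mul_one] at hpow
  simp only [Finset.prod_const, Finset.card_univ, Fintype.card_fin] at hprod
  exact hprod.trans hpow

theorem not_isGammaPole {s : ℂ} (hs : ∀ i, 0 < α i * s.re + (β i).re) : ¬ IsGammaPole α β s := by
  rintro ⟨i, m, h⟩
  have hre := congrArg re h
  rw [add_re, re_ofReal_mul, neg_re, natCast_re] at hre
  linarith [hs i, m.cast_nonneg (α := ℝ)]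

theorem differentiableAt_gammaFactor {s : ℂ} (hs : ∀ i, 0 < α i * s.re + (β i).re) :
    DifferentiableAt ℂ (gammaFactor α β) s :=
  DifferentiableAt.fun_finsetProd fun i _ =>
    DifferentiableAt.comp s (differentiableAt_Gamma _ fun m h => not_isGammaPole hs ⟨i, m, h⟩)
      (by fun_prop)

end GammaFactor

section ZFunction

variable {r : ℕ} {α : Fin r → ℝ} {β : Fin r → ℂ} {κ κ' x : ℝ}

theorem verticalIntegrable_gammaFactor (hr : 0 < r) (hα : ∀ i, 0 < α i)
    (hκ : ∀ i, 0 < α i * κ + (β i).re) : VerticalIntegrable (gammaFactor α β) κ :=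
  verticalIntegrable_of_isBigO_inv_sq
    (fun _ hz => differentiableAt_gammaFactor fun i => hz.symm ▸ hκ i)
    (gammaFactor_isBigO_inv_sq hr hα hκ κ)

theorem zFun_congr_line (hr : 0 < r) (hα : ∀ i, 0 < α i) (hκ : ∀ i, 0 < α i * κ + (β i).re)
    (hκ' : ∀ i, 0 < α i * κ' + (β i).re) (hx : 0 < x) : zFun α β κ x = zFun α β κ' x := by
  wlog h : κ ≤ κ' generalizing κ κ'
  · exact (this hκ' hκ (not_le.1 h).le).symm
  refine mellinInv_congr_line hx h (fun z hz _ => differentiableAt_gammaFactor fun i => ?_)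
    (gammaFactor_isBigO_inv_sq hr hα hκ κ')
  have := (hα i).le
  exact (hκ i).trans_le (by gcongr)

end ZFunction

section DirichletSeries

open scoped ComplexConjugate

variable {c : ℕ → ℂ} {ν : ℕ → ℝ} {σ κ x : ℝ}

theorem IsDirichletSeries.summable_norm (h : IsDirichletSeries c ν σ) (hσ : σ < κ) :
    Summable fun n => ‖c n‖ / ν n ^ κ := by
  have hlt : abscissaAbs c ν < κ := by
    rw [h.abscissa]
    exact_mod_cast hσ
  obtain ⟨_, ⟨y, hy, rfl⟩, hyκ⟩ := sInf_lt_iff.1 hlt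
  have hyκ : y < κ := EReal.coe_lt_coe_iff.1 hyκ
  refine Summable.of_norm_bounded_eventually_nat (g := fun n => ‖c n‖ / ν n ^ y) hy ?_
  filter_upwards [h.tendsto.eventually_ge_atTop 1] with n hn
  have := h.pos n
  rw [Real.norm_of_nonneg (by positivity)]
  gcongr

theorem IsDirichletSeries.star (h : IsDirichletSeries c ν σ) :
    IsDirichletSeries (fun n => conj (c n)) ν σ :=
  ⟨h.pos, h.strictMono, h.tendsto, by simpa [abscissaAbs] using h.abscissa⟩

theorem IsDirichletSeries.isBigO_one (h : IsDirichletSeries c ν σ) (hσ : σ < κ) :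
    dirichletSeries c ν =O[𝓟 {s | s.re = κ}] fun _ => (1 : ℂ) := by
  refine IsBigO.of_bound (∑' n, ‖c n‖ / ν n ^ κ) <| eventually_principal.2 fun s hs => ?_
  have hterm : ∀ n, ‖c n / (ν n : ℂ) ^ s‖ = ‖c n‖ / ν n ^ κ := fun n => by
    rw [norm_div, norm_cpow_eq_rpow_re_of_pos (h.pos n), hs]
  rw [norm_one, mul_one]
  exact tsum_of_norm_bounded (h.summable_norm hσ).hasSum fun n => (hterm n).le

theorem IsDirichletSeries.hasSum_mul_mellinInv (h : IsDirichletSeries c ν σ) (hσ : σ < κ)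
    {f : ℂ → ℂ} (hf : VerticalIntegrable f κ) (hx : 0 < x) :
    HasSum (fun n => c n * mellinInv κ f (ν n * x))
      (mellinInv κ (fun s => dirichletSeries c ν s * f s) x) := by
  set F : ℕ → ℝ → ℂ := fun n y =>
    c n * (((ν n * x : ℝ) : ℂ) ^ (-((κ : ℂ) + y * I)) * f (κ + y * I)) with hF
  have hFint : ∀ n, Integrable (F n) := fun n =>
    (verticalIntegrable_cpow_neg_mul (mul_pos (h.pos n) hx) hf).const_mul (c n)
  have hFnorm : ∀ n y, ‖F n y‖ = ‖c n‖ / ν n ^ κ * x ^ (-κ) * ‖f (κ + y * I)‖ := fun n y => by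
    have hν := h.pos n
    simp only [hF, norm_mul]
    rw [norm_ofReal_cpow_neg (mul_pos hν hx), Real.mul_rpow hν.le hx.le, add_re, ofReal_re,
      re_ofReal_mul, I_re, mul_zero, add_zero, Real.rpow_neg hν.le]
    ring
  have hFsum : Summable fun n => ∫ y, ‖F n y‖ := by
    simp only [hFnorm, integral_const_mul]
    exact ((h.summable_norm hσ).mul_right _).mul_right _
  have hFtsum : ∀ y : ℝ, ∑' n, F n y =
      (x : ℂ) ^ (-((κ : ℂ) + y * I)) • (dirichletSeries c ν (κ + y * I) * f (κ + y * I)) :=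
    fun y => by
      rw [dirichletSeries, smul_eq_mul, ← tsum_mul_right, ← tsum_mul_left]
      refine tsum_congr fun n => ?_
      simp only [hF]
      rw [ofReal_mul, mul_cpow_ofReal_nonneg (h.pos n).le hx.le, cpow_neg (ν n : ℂ)]
      ring
  have hsum := (hasSum_integral_of_summable_integral_norm hFint hFsum).const_smul
    (1 / (2 * Real.pi))
  simp only [hFtsum] at hsum
  refine hsum.congr_fun fun n => ?_
  simp only [mellinInv, hF, integral_const_mul, smul_eq_mul, real_smul]
  ring

end DirichletSeries

section CompletedSeries

open scoped ComplexConjugate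

variable {r : ℕ} {c : ℕ → ℂ} {ν : ℕ → ℝ} {σ κ κ' x : ℝ} {α : Fin r → ℝ} {β : Fin r → ℂ}

theorem IsDirichletSeries.completedSeries_isBigO_inv_sq (h : IsDirichletSeries c ν σ) (hr : 0 < r)
    (hα : ∀ i, 0 < α i) (hσ : σ < κ) (hκ : ∀ i, 0 < α i * κ + (β i).re) :
    completedSeries c ν α β =O[stripAtInfty κ κ] fun s => (s ^ 2)⁻¹ := by
  have hline : stripAtInfty κ κ ≤ 𝓟 {s | s.re = κ} := le_principal_iff.2 <| by
    filter_upwards [eventually_mem_strip κ κ] with s hs using le_antisymm hs.2 hs.1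
  exact (((h.isBigO_one hσ).mono hline).mul (gammaFactor_isBigO_inv_sq hr hα hκ κ)).congr_right
    fun _ => one_mul _

theorem IsDirichletSeries.hasSum_mul_zFun (h : IsDirichletSeries c ν σ) (hr : 0 < r)
    (hα : ∀ i, 0 < α i) (hκ : ∀ i, 0 < α i * κ + (β i).re) (hσ : σ < κ')
    (hκ' : ∀ i, 0 < α i * κ' + (β i).re) (hx : 0 < x) :
    HasSum (fun n => c n * zFun α β κ (ν n * x)) (mellinInv κ' (completedSeries c ν α β) x) := by
  simp only [fun n => zFun_congr_line hr hα hκ hκ' (mul_pos (h.pos n) hx)]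
  exact h.hasSum_mul_mellinInv hσ (verticalIntegrable_gammaFactor hr hα hκ') hx

theorem conj_ofReal_cpow (hx : 0 < x) (s : ℂ) :
    conj ((x : ℂ) ^ s) = (x : ℂ) ^ conj s := by
  rw [cpow_conj _ _ (by rw [arg_ofReal_of_nonneg hx.le]; exact Real.pi_pos.ne), conj_ofReal]

theorem conj_completedSeries (hν : ∀ n, 0 < ν n) (α : Fin r → ℝ) (β : Fin r → ℂ) (s : ℂ) :
    conj (completedSeries c ν α β s) =
      completedSeries (fun n => conj (c n)) ν α (fun i => conj (β i)) (conj s) := by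
  simp only [completedSeries, dirichletSeries, gammaFactor, map_mul, map_prod, conj_tsum, map_div₀,
    conj_ofReal_cpow (hν _), ← Complex.Gamma_conj, map_add, conj_ofReal]

end CompletedSeries

theorem CircleEnclosesSingularities.exists_differentiableAt {S : Set ℂ} {F : ℂ → ℂ} {c : ℂ}
    {R : ℝ} (hC : CircleEnclosesSingularities S F c R) :
    ∃ g : ℂ → ℂ, (∀ z, R ≤ dist z c → DifferentiableAt ℂ g z) ∧ EqOn g F Sᶜ := by
  obtain ⟨-, hsphere, g, hg, hgF⟩ := hC
  refine ⟨g, fun z hz => (hg z ?_).differentiableAt, hgF⟩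
  rcases hz.eq_or_lt with h | h
  · exact .inl (hsphere h.symm)
  · exact .inr (by simpa using h)

section Congr

variable {F G : ℂ → ℂ} {c : ℂ} {R : ℝ}

theorem principalPart_congr (hR : 0 ≤ R) (h : EqOn F G (Metric.sphere c R)) :
    principalPart F c R = principalPart G c R := by
  ext s
  simp only [principalPart]
  congr 1
  exact circleIntegral.integral_congr hR fun w hw => by simp only [h hw]

theorem residualIntegral_congr (hR : 0 ≤ R) (h : EqOn F G (Metric.sphere c R)) :
    residualIntegral F c R = residualIntegral G c R := by
  ext x
  simp only [residualIntegral]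
  congr 1
  exact circleIntegral.integral_congr hR fun s hs => by simp only [h hs]

end Congr

section ResidualFunction

variable {F : ℂ → ℂ} {c : ℂ} {R x : ℝ}

theorem hasDerivAt_circleIntegral {K K' : ℝ → ℂ → ℂ} {U : Set ℝ} (hU : IsOpen U) (hR : 0 ≤ R)
    (hK : ContinuousOn K.uncurry (U ×ˢ Metric.sphere c R))
    (hK' : ContinuousOn K'.uncurry (U ×ˢ Metric.sphere c R))
    (hKK' : ∀ y ∈ U, ∀ w ∈ Metric.sphere c R, HasDerivAt (K · w) (K' y w) y) (hx : x ∈ U) :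
    HasDerivAt (fun y => ∮ w in C(c, R), K y w) (∮ w in C(c, R), K' x w) x := by
  have hm : ∀ θ, circleMap c R θ ∈ Metric.sphere c R := circleMap_mem_sphere c hR
  obtain ⟨ε, hε, hεU⟩ := Metric.nhds_basis_closedBall.mem_iff.1 (hU.mem_nhds hx)
  obtain ⟨B, hB⟩ := ((isCompact_closedBall x ε).prod
    (isCompact_sphere c R)).exists_bound_of_continuousOn (hK'.mono (prod_mono_left hεU))
  have hcont : ∀ {L : ℝ → ℂ → ℂ}, ContinuousOn L.uncurry (U ×ˢ Metric.sphere c R) → ∀ y ∈ U,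
      Continuous fun θ => deriv (circleMap c R) θ • L y (circleMap c R θ) := fun hL y hy => by
    simp only [deriv_circleMap]
    exact ((continuous_circleMap 0 R).mul continuous_const).smul
      (hL.comp_continuous (continuous_const.prodMk (continuous_circleMap c R))
        fun θ => ⟨hy, hm θ⟩)
  refine (intervalIntegral.hasDerivAt_integral_of_dominated_loc_of_deriv_le
    (F' := fun y θ => deriv (circleMap c R) θ • K' y (circleMap c R θ)) (bound := fun _ => R * B)
    (Metric.closedBall_mem_nhds x hε) ?_ ((hcont hK x hx).intervalIntegrable _ _)
    (hcont hK' x hx).aestronglyMeasurable ?_ intervalIntegrable_const ?_).2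
  · filter_upwards [hU.mem_nhds hx] with y hy using (hcont hK y hy).aestronglyMeasurable
  · refine Eventually.of_forall fun θ _ y hy => ?_
    rw [norm_smul, deriv_circleMap, norm_mul, norm_circleMap_zero, norm_I, mul_one,
      abs_of_nonneg hR]
    exact mul_le_mul_of_nonneg_left (hB (y, _) ⟨hy, hm θ⟩) hR
  · exact Eventually.of_forall fun θ _ y hy => (hKK' y (hεU hy) _ (hm θ)).fun_const_smul _

theorem continuousOn_mul_ofReal_cpow (hF : ContinuousOn F (Metric.sphere c R)) {p : ℂ → ℂ}
    (hp : Continuous p) :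
    ContinuousOn (fun (x : ℝ) w => F w * (x : ℂ) ^ p w).uncurry (Ioi 0 ×ˢ Metric.sphere c R) :=
  (hF.comp continuousOn_snd fun _ h => h.2).mul <|
    (continuous_ofReal.comp continuous_fst).continuousOn.cpow
      (hp.comp continuous_snd).continuousOn fun _ h => ofReal_mem_slitPlane.2 h.1

theorem differentiableOn_residualIntegral (hR : 0 ≤ R) (hF : ContinuousOn F (Metric.sphere c R)) :
    DifferentiableOn ℝ (residualIntegral F c R) (Ioi 0) := fun x hx =>
  ((hasDerivAt_circleIntegral isOpen_Ioi hR (continuousOn_mul_ofReal_cpow hF continuous_neg)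
    (continuousOn_mul_ofReal_cpow (hF.mul continuousOn_id.neg)
      (continuous_neg.sub continuous_const)) (fun y hy w _ => by
        have hpow := (hasDerivAt_id (y : ℂ)).cpow_const (c := -w)
          (ofReal_mem_slitPlane.2 hy)
        simpa [mul_assoc] using hpow.comp_ofReal.const_mul (F w))
    hx).const_mul _).differentiableAt.differentiableWithinAt

theorem abs_re_le_of_mem_sphere {w : ℂ} (hw : w ∈ Metric.sphere c R) : |w.re| ≤ ‖c‖ + R := by
  have := norm_sub_norm_le w c
  rw [← dist_eq_norm, Metric.mem_sphere.1 hw] at this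
  linarith [abs_re_le_norm w]

theorem norm_ofReal_cpow_le_of_le_one {z : ℂ} {k : ℝ} (hx : 0 < x) (hx1 : x ≤ 1)
    (hk : k ≤ z.re) : ‖(x : ℂ) ^ z‖ ≤ x ^ k := by
  rw [norm_cpow_eq_rpow_re_of_pos hx]
  exact Real.rpow_le_rpow_of_exponent_ge hx hx1 hk

theorem norm_ofReal_cpow_le_of_one_le {z : ℂ} {k : ℝ} (hx : 1 ≤ x) (hk : z.re ≤ k) :
    ‖(x : ℂ) ^ z‖ ≤ x ^ k := by
  rw [norm_cpow_eq_rpow_re_of_pos (one_pos.trans_le hx)]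
  exact Real.rpow_le_rpow_of_exponent_le hx hk

theorem residualIntegral_isBigO (hR : 0 ≤ R) (hF : ContinuousOn F (Metric.sphere c R))
    {l : Filter ℝ} {k : ℝ}
    (hl : ∀ᶠ x : ℝ in l, ∀ w ∈ Metric.sphere c R, ‖(x : ℂ) ^ (-w)‖ ≤ x ^ k) :
    residualIntegral F c R =O[l] fun x => x ^ k := by
  obtain ⟨B, hB⟩ := (isCompact_sphere c R).exists_bound_of_continuousOn hF
  refine IsBigO.of_bound (R * B) ?_
  filter_upwards [hl] with x hx
  rw [mul_assoc]
  refine circleIntegral.norm_two_pi_i_inv_smul_integral_le_of_norm_le_const hR fun w hw => ?_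
  rw [norm_mul]
  exact mul_le_mul (hB w hw) ((hx w hw).trans (le_abs_self _)) (norm_nonneg _)
    ((norm_nonneg _).trans (hB w hw))

theorem residualIntegral_mul_cpow (hR : 0 ≤ R) (hx : 0 < x) (s : ℂ) :
    residualIntegral F c R x * (x : ℂ) ^ (s - 1) =
      (2 * Real.pi * I : ℂ)⁻¹ * ∮ w in C(c, R), F w * (x : ℂ) ^ (s - 1 - w) := by
  rw [residualIntegral, mul_assoc, mul_comm (circleIntegral _ _ _),
    ← circleIntegral.integral_const_mul]
  refine congrArg _ (circleIntegral.integral_congr hR fun w _ => ?_)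
  simp only [sub_eq_add_neg (s - 1) w, cpow_add _ _ (ofReal_ne_zero.2 hx.ne')]
  ring

theorem integral_residualIntegral_mul_cpow (hR : 0 ≤ R) (hF : ContinuousOn F (Metric.sphere c R))
    {A : Set ℝ} (hA : MeasurableSet A) (hA0 : A ⊆ Ioi 0) {D : ℝ → ℝ} (hD : IntegrableOn D A)
    {s : ℂ} (hDs : ∀ x ∈ A, ∀ w ∈ Metric.sphere c R, ‖(x : ℂ) ^ (s - 1 - w)‖ ≤ D x) :
    IntegrableOn (fun x : ℝ => residualIntegral F c R x * (x : ℂ) ^ (s - 1)) A ∧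
      ∫ x in A, residualIntegral F c R x * (x : ℂ) ^ (s - 1) =
        (2 * Real.pi * I : ℂ)⁻¹ * ∮ w in C(c, R), F w * ∫ x in A, (x : ℂ) ^ (s - 1 - w) := by
  obtain ⟨B, hB⟩ := (isCompact_sphere c R).exists_bound_of_continuousOn hF
  have hK := (continuousOn_mul_ofReal_cpow hF (p := fun w => s - 1 - w) (by fun_prop)).mono
    (prod_mono_left hA0)
  have hBD : IntegrableOn (fun x => B * D x) A := hD.const_mul B
  have hKBD : ∀ x ∈ A, ∀ w ∈ Metric.sphere c R, ‖F w * (x : ℂ) ^ (s - 1 - w)‖ ≤ B * D x :=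
    fun x hx w hw => by
      rw [norm_mul]
      exact mul_le_mul (hB w hw) (hDs x hx w hw) (norm_nonneg _) ((norm_nonneg _).trans (hB w hw))
  have hmul : EqOn _ _ A := fun x hx => residualIntegral_mul_cpow (F := F) (c := c) hR (hA0 hx) s
  rw [integrableOn_congr_fun hmul hA, setIntegral_congr_fun hA hmul, integral_const_mul,
    integral_circleIntegral_swap hA hR hK hBD hKBD]
  simp only [integral_const_mul]
  exact ⟨(integrableOn_circleIntegral hA hR hK hBD hKBD).const_mul _, trivial⟩

theorem integral_Ioc_residualIntegral (hR : 0 ≤ R) (hF : ContinuousOn F (Metric.sphere c R)) {s : ℂ}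
    (hs : ‖c‖ + R < s.re) :
    IntegrableOn (fun x : ℝ => residualIntegral F c R x * (x : ℂ) ^ (s - 1)) (Ioc 0 1) ∧
      ∫ x in Ioc (0 : ℝ) 1, residualIntegral F c R x * (x : ℂ) ^ (s - 1) =
        principalPart F c R s := by
  have hw : ∀ w ∈ Metric.sphere c R, w.re ≤ ‖c‖ + R := fun w hw =>
    (le_abs_self _).trans (abs_re_le_of_mem_sphere hw)
  have hD : IntegrableOn (fun x : ℝ => x ^ (s.re - 1 - (‖c‖ + R))) (Ioc 0 1) := by
    rw [← intervalIntegrable_iff_integrableOn_Ioc_of_le zero_le_one]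
    exact intervalIntegral.intervalIntegrable_rpow' (by linarith)
  obtain ⟨hint, heq⟩ := integral_residualIntegral_mul_cpow hR hF measurableSet_Ioc
    Ioc_subset_Ioi_self hD (s := s) fun x hx w hwR =>
      norm_ofReal_cpow_le_of_le_one hx.1 hx.2 (by simp only [sub_re, one_re]; linarith [hw w hwR])
  refine ⟨hint, heq.trans (congrArg _ (circleIntegral.integral_congr hR fun w hwR => ?_))⟩
  have hsw : 0 < (s - w).re := by rw [sub_re]; linarith [hw w hwR]
  have hexp : s - 1 - w + 1 = s - w := by ring
  rw [← intervalIntegral.integral_of_le zero_le_one,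
    integral_cpow (.inl (by simp only [sub_re, one_re] at hsw ⊢; linarith)), hexp, ofReal_zero,
    zero_cpow fun h => by simp [h] at hsw]
  simp [mul_comm]

theorem integral_Ioi_residualIntegral (hR : 0 ≤ R) (hF : ContinuousOn F (Metric.sphere c R)) {s : ℂ}
    (hs : s.re < -(‖c‖ + R)) :
    IntegrableOn (fun x : ℝ => residualIntegral F c R x * (x : ℂ) ^ (s - 1)) (Ioi 1) ∧
      -∫ x in Ioi (1 : ℝ), residualIntegral F c R x * (x : ℂ) ^ (s - 1) =
        principalPart F c R s := by
  have hw : ∀ w ∈ Metric.sphere c R, -w.re ≤ ‖c‖ + R := fun w hw =>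
    (neg_le_abs _).trans (abs_re_le_of_mem_sphere hw)
  obtain ⟨hint, heq⟩ := integral_residualIntegral_mul_cpow hR hF measurableSet_Ioi
    (Ioi_subset_Ioi zero_le_one)
    (integrableOn_Ioi_rpow_of_lt (a := s.re - 1 + (‖c‖ + R)) (by linarith) one_pos) (s := s)
    fun x hx w hwR => norm_ofReal_cpow_le_of_one_le (le_of_lt hx)
      (by simp only [sub_re, one_re]; linarith [hw w hwR])
  refine ⟨hint, ?_⟩
  rw [heq, principalPart, ← mul_neg, ← neg_one_mul, ← circleIntegral.integral_const_mul]
  refine congrArg _ (circleIntegral.integral_congr hR fun w hwR => ?_)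
  have hexp : s - 1 - w + 1 = s - w := by ring
  rw [integral_Ioi_cpow_of_lt (by simp only [sub_re, one_re]; linarith [hw w hwR]) one_pos, hexp,
    ofReal_one, one_cpow]
  ring

theorem CircleEnclosesSingularities.exists_eq_principalPart {S : Set ℂ} (hS : IsCompact S)
    (hF : AnalyticOnNhd ℂ F Sᶜ) (hC : CircleEnclosesSingularities S F c R) :
    ∃ J : ℂ → ℂ, AnalyticOnNhd ℂ J Sᶜ ∧ ∃ K : ℝ, ∀ s, K < ‖s‖ → J s = principalPart F c R s := by
  obtain ⟨g, hg, hgF⟩ := hC.exists_differentiableAt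
  obtain ⟨E, hE, hgE⟩ := exists_entire_add_principalPart hC.1 hg
  obtain ⟨K, hK⟩ := hS.isBounded.exists_norm_le
  have hgF' : principalPart g c R = principalPart F c R :=
    principalPart_congr hC.1.le (hgF.mono hC.2.1)
  refine ⟨fun s => F s - E s, hF.sub fun z _ => hE.analyticAt z, max K (‖c‖ + R), fun s hs => ?_⟩
  obtain ⟨hsK, hsR⟩ := max_lt_iff.1 hs
  have hsc : R < dist s c := by
    rw [dist_eq_norm]
    linarith [norm_sub_norm_le s c]
  beta_reduce
  rw [← hgF (fun h => hsK.not_ge (hK s h) : s ∈ Sᶜ), hgE s hsc, hgF', add_sub_cancel_left]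

theorem isResidualFunction_residualIntegral {S : Set ℂ} (hS : IsCompact S)
    (hF : AnalyticOnNhd ℂ F Sᶜ) (hC : CircleEnclosesSingularities S F c R) :
    IsResidualFunction S (residualIntegral F c R) := by
  have hR : 0 < R := hC.1
  have hFR : ContinuousOn F (Metric.sphere c R) := hF.continuousOn.mono hC.2.1
  obtain ⟨J, hJ, K, hJK⟩ := hC.exists_eq_principalPart hS hF
  refine ⟨differentiableOn_residualIntegral hR.le hFR, ⟨‖c‖ + R, by positivity, ?_, ?_⟩,
    J, hJ, ⟨max K (‖c‖ + R), fun s hs => ?_⟩, ⟨-max K (‖c‖ + R), fun s hs => ?_⟩,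
    fun σ₁ σ₂ _ => Tendsto.mono_left ?_ inf_le_left⟩
  · refine residualIntegral_isBigO hR.le hFR ?_
    filter_upwards [Ioc_mem_nhdsGT (zero_lt_one' ℝ)] with x hx w hw
    exact norm_ofReal_cpow_le_of_le_one hx.1 hx.2
      (neg_le_neg ((le_abs_self _).trans (abs_re_le_of_mem_sphere hw)))
  · refine residualIntegral_isBigO hR.le hFR ?_
    filter_upwards [eventually_ge_atTop 1] with x hx w hw
    exact norm_ofReal_cpow_le_of_one_le hx ((neg_le_abs _).trans (abs_re_le_of_mem_sphere hw))
  · obtain ⟨hsK, hsR⟩ := max_lt_iff.1 hs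
    obtain ⟨hint, heq⟩ := integral_Ioc_residualIntegral hR.le hFR hsR
    exact ⟨hint, (hJK s (hsK.trans_le (re_le_norm s))).trans heq.symm⟩
  · obtain ⟨hsK, hsR⟩ := max_lt_iff.1 (lt_neg.1 hs)
    obtain ⟨hint, heq⟩ := integral_Ioi_residualIntegral hR.le hFR (lt_neg.1 hsR)
    exact ⟨hint, (hJK s (hsK.trans_le ((neg_le_abs _).trans (abs_re_le_norm s)))).trans heq.symm⟩
  · refine (tendsto_principalPart hR.le hFR).congr' ?_
    filter_upwards [tendsto_norm_cobounded_atTop.eventually_gt_atTop K] with s hs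
      using (hJK s hs).symm

end ResidualFunction

section Reflection

variable {Q δ κ x : ℝ} {ω : ℂ} {f g H : ℂ → ℂ}

/-- The reflection `s ↦ δ - s` of the functional equation: the right side of the equation, divided
by `Q ^ s`, is `reflection Q δ ω H s` with `H s = conj (G (conj s))`. -/
noncomputable def reflection (Q δ : ℝ) (ω : ℂ) (H : ℂ → ℂ) (s : ℂ) : ℂ :=
  ω * (Q : ℂ) ^ ((δ : ℂ) - 2 * s) * H (δ - s)

theorem cpow_reflect_mul (hx : 0 < x) (hQ : 0 < Q) (δ : ℝ) (u : ℂ) :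
    (x : ℂ) ^ (-((δ : ℂ) - u)) * (Q : ℂ) ^ ((δ : ℂ) - 2 * (δ - u)) =
      (((x * Q) ^ δ : ℝ) : ℂ)⁻¹ * ((1 / (Q ^ 2 * x) : ℝ) : ℂ) ^ (-u) := by
  have hy : 0 < 1 / (Q ^ 2 * x) := by positivity
  have hlog : Real.log (1 / (Q ^ 2 * x)) = -(2 * Real.log Q + Real.log x) := by
    rw [one_div, Real.log_inv, Real.log_mul (pow_ne_zero 2 hQ.ne') hx.ne', Real.log_pow,
      Nat.cast_ofNat]
  rw [cpow_def_of_ne_zero (ofReal_ne_zero.2 hx.ne'), cpow_def_of_ne_zero (ofReal_ne_zero.2 hQ.ne'),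
    cpow_def_of_ne_zero (ofReal_ne_zero.2 hy.ne'), Real.rpow_def_of_pos (mul_pos hx hQ),
    Real.log_mul hx.ne' hQ.ne', ← ofReal_log hx.le, ← ofReal_log hQ.le, ← ofReal_log hy.le, hlog,
    ofReal_exp, ← Complex.exp_neg, ← Complex.exp_add, ← Complex.exp_add]
  push_cast
  ring_nf

theorem mellinInv_congr (h : ∀ s : ℂ, s.re = κ → f s = g s) (x : ℝ) :
    mellinInv κ f x = mellinInv κ g x := by
  simp only [mellinInv, fun y : ℝ => h (κ + y * I) (by simp)]

theorem mellinInv_reflection (hx : 0 < x) (hQ : 0 < Q) (δ κ : ℝ) (ω : ℂ) (H : ℂ → ℂ) :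
    mellinInv (δ - κ) (reflection Q δ ω H) x =
      ω / (((x * Q) ^ δ : ℝ) : ℂ) * mellinInv κ H (1 / (Q ^ 2 * x)) := by
  have hintegrand : ∀ y : ℝ,
      (x : ℂ) ^ (-(((δ - κ : ℝ) : ℂ) + (-y : ℝ) * I)) •
          reflection Q δ ω H (((δ - κ : ℝ) : ℂ) + (-y : ℝ) * I) =
        ω / (((x * Q) ^ δ : ℝ) : ℂ) *
          (((1 / (Q ^ 2 * x) : ℝ) : ℂ) ^ (-((κ : ℂ) + y * I)) • H (κ + y * I)) := fun y => by
    have hline : ((δ - κ : ℝ) : ℂ) + (-y : ℝ) * I = δ - (κ + y * I) := by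
      push_cast
      ring
    rw [hline, reflection, sub_sub_cancel, smul_eq_mul, smul_eq_mul]
    linear_combination ω * H (κ + y * I) * cpow_reflect_mul hx hQ δ (κ + y * I)
  rw [mellinInv, mellinInv, ← integral_neg_eq_self]
  simp only [hintegrand]
  rw [integral_const_mul, mul_smul_comm]

theorem reflection_isBigO_inv_sq (hQ : 0 < Q) (δ : ℝ) (ω : ℂ)
    (hH : H =O[stripAtInfty κ κ] fun s => (s ^ 2)⁻¹) :
    reflection Q δ ω H =O[stripAtInfty (δ - κ) (δ - κ)] fun s => (s ^ 2)⁻¹ := by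
  have hcobounded : stripAtInfty (δ - κ) (δ - κ) ≤ Bornology.cobounded ℂ :=
    stripAtInfty_le_cobounded _ _
  have haffine : ∀ s : ℂ, δ - s = -1 * s + δ := fun s => by ring
  have hreflect : Tendsto (fun s : ℂ => δ - s) (stripAtInfty (δ - κ) (δ - κ))
      (stripAtInfty κ κ) := by
    refine tendsto_inf.2 ⟨?_, tendsto_principal.2 ?_⟩
    · simpa only [haffine] using
        (tendsto_affine_cobounded (neg_ne_zero.2 one_ne_zero) (δ : ℂ)).mono_left hcobounded
    · filter_upwards [eventually_mem_strip (δ - κ) (δ - κ)] with s hs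
      rw [sub_re, ofReal_re]
      constructor <;> linarith
  have hpow : (fun s : ℂ => ω * (Q : ℂ) ^ ((δ : ℂ) - 2 * s))
      =O[stripAtInfty (δ - κ) (δ - κ)] fun _ => (1 : ℂ) := by
    refine IsBigO.of_bound (‖ω‖ * Q ^ (2 * κ - δ)) ?_
    filter_upwards [eventually_mem_strip (δ - κ) (δ - κ)] with s hs
    have hre : ((δ : ℂ) - 2 * s).re = 2 * κ - δ := by
      simp only [sub_re, ofReal_re, mul_re, re_ofNat, im_ofNat, zero_mul, sub_zero]
      linarith
    rw [norm_mul, norm_cpow_eq_rpow_re_of_pos hQ, hre, norm_one, mul_one]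
  refine (hpow.mul ((hH.comp_tendsto hreflect).trans ?_)).congr_right fun s => one_mul _
  simpa only [Function.comp_def, haffine] using
    (inv_sq_affine_isBigO (neg_ne_zero.2 one_ne_zero) (δ : ℂ)).mono hcobounded

theorem mellinInv_eq_residualIntegral_add_of_reflection {c : ℂ} {R θ : ℝ} (hx : 0 < x) (hQ : 0 < Q)
    (hR : 0 < R) (hg : ∀ z, R ≤ dist z c → DifferentiableAt ℂ g z) (hθ : θ < 1)
    (hgrowth : g =O[stripAtInfty (δ - κ) κ]
      fun s => Real.exp (Real.exp (θ * Real.pi * ‖s‖ / (κ - (δ - κ)))))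
    (hright : ∀ s : ℂ, s.re = κ → g s = f s)
    (hleft : ∀ s : ℂ, s.re = δ - κ → g s = reflection Q δ ω H s)
    (hf : f =O[stripAtInfty κ κ] fun s => (s ^ 2)⁻¹)
    (hH : H =O[stripAtInfty κ κ] fun s => (s ^ 2)⁻¹)
    (hδκ : δ - κ < c.re - R) (hκ : c.re + R < κ) :
    mellinInv κ f x = residualIntegral g c R x +
      ω / (((x * Q) ^ δ : ℝ) : ℂ) * mellinInv κ H (1 / (Q ^ 2 * x)) := by
  have hline : ∀ {p : ℝ} {k : ℂ → ℂ}, (∀ s : ℂ, s.re = p → g s = k s) →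
      k =ᶠ[stripAtInfty p p] g := fun {p _} h =>
    (eventually_mem_strip p p).mono fun s hs => (h s (le_antisymm hs.2 hs.1)).symm
  have hO := isBigO_inv_sq_of_isBigO_exp_exp (by linarith) hR hg hθ hgrowth
    ((reflection_isBigO_inv_sq hQ δ ω hH).congr' (hline hleft) .rfl)
    (hf.congr' (hline hright) .rfl)
  rw [← mellinInv_sub_mellinInv_eq_residualIntegral hx hR hg hδκ hκ hO, mellinInv_congr hright,
    mellinInv_congr hleft, mellinInv_reflection hx hQ, sub_add_cancel]

end Reflection

section FunctionalEquation

open scoped ComplexConjugate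

variable {r : ℕ} {a b : ℕ → ℂ} {lam mu : ℕ → ℝ} {σa σb : ℝ} {α : Fin r → ℝ} {β : Fin r → ℂ}
  {Q δ : ℝ} {ω s : ℂ} {S : Set ℂ} {χ : ℂ → ℂ}

theorem FunctionalEquation.continuedF_eq_completedSeries
    (hFE : FunctionalEquation a lam σa b mu σb α β Q δ ω S χ) (hQ : 0 < Q) (hs : s ∈ Sᶜ)
    (hσ : σa < s.re) (hpos : ∀ i, 0 < α i * s.re + (β i).re) :
    continuedF Q χ s = completedSeries a lam α β s := by
  have hQ0 : (Q : ℂ) ≠ 0 := ofReal_ne_zero.2 hQ.ne'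
  rw [continuedF, hFE.eq_right s hs hσ (not_isGammaPole hpos), cpow_neg,
    inv_mul_cancel_left₀ (cpow_ne_zero_iff.2 (.inl hQ0))]

theorem FunctionalEquation.continuedF_eq_reflection
    (hFE : FunctionalEquation a lam σa b mu σb α β Q δ ω S χ) (hQ : 0 < Q) (hmu : ∀ n, 0 < mu n)
    (hs : s ∈ Sᶜ) (hσ : s.re < δ - σb) (hpos : ∀ i, 0 < α i * (δ - s.re) + (β i).re) :
    continuedF Q χ s = reflection Q δ ω
      (completedSeries (fun n => conj (b n)) mu α fun i => conj (β i)) s := by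
  have hpow : (Q : ℂ) ^ ((δ : ℂ) - 2 * s) = (Q : ℂ) ^ (-s) * (Q : ℂ) ^ ((δ : ℂ) - s) := by
    rw [← cpow_add _ _ (ofReal_ne_zero.2 hQ.ne')]
    ring_nf
  rw [continuedF, hFE.eq_left s hs hσ (not_isGammaPole (by simpa using hpos)),
    conj_completedSeries hmu, reflection, hpow, map_sub, conj_ofReal, conj_conj]
  ring

theorem analyticOnNhd_continuedF (hQ : 0 < Q) (hχ : AnalyticOnNhd ℂ χ Sᶜ) :
    AnalyticOnNhd ℂ (continuedF Q χ) Sᶜ :=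
  AnalyticOnNhd.mul (fun z _ => (differentiable_ofReal_cpow_neg hQ).analyticAt z) hχ

theorem eventually_gammaFactor_arg_pos (hα : ∀ i, 0 < α i) (β : Fin r → ℂ) :
    ∀ᶠ κ in atTop, ∀ i, 0 < α i * κ + (β i).re :=
  eventually_all.2 fun i =>
    (tendsto_atTop_add_const_right _ _ (tendsto_id.const_mul_atTop (hα i))).eventually_gt_atTop 0

theorem eventually_forall_le_abs_re_mem_compl (hS : IsCompact S) :
    ∀ᶠ κ in atTop, ∀ s : ℂ, κ ≤ |s.re| → s ∈ Sᶜ := by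
  obtain ⟨L, hL⟩ := hS.isBounded.exists_norm_le
  filter_upwards [eventually_gt_atTop L] with κ hκ s hs hsS
  exact (hκ.trans_le (hs.trans (abs_re_le_norm s))).not_ge (hL s hsS)

theorem FunctionalEquation.eventually_mellinInv_eq (hr : 0 < r) (hφ : IsDirichletSeries a lam σa)
    (hψ : IsDirichletSeries b mu σb) (hα : ∀ i, 0 < α i) (hQ : 0 < Q)
    (hFE : FunctionalEquation a lam σa b mu σb α β Q δ ω S χ) {c : ℂ} {R : ℝ}
    (hC : CircleEnclosesSingularities S (continuedF Q χ) c R) :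
    ∀ᶠ κ in atTop, ∀ x : ℝ, 0 < x → mellinInv κ (completedSeries a lam α β) x =
      residualIntegral (continuedF Q χ) c R x + ω / (((x * Q) ^ δ : ℝ) : ℂ) *
        mellinInv κ (completedSeries (fun n => conj (b n)) mu α fun i => conj (β i))
          (1 / (Q ^ 2 * x)) := by
  obtain ⟨g, hg, hgF⟩ := hC.exists_differentiableAt
  obtain ⟨θ, hθ, hgrowth⟩ := hFE.growth
  obtain ⟨L, hL⟩ := (eventually_forall_le_abs_re_mem_compl hFE.isCompact).exists
  filter_upwards [eventually_gt_atTop σa, eventually_gt_atTop σb, eventually_gt_atTop (c.re + R),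
    eventually_gt_atTop (δ - (c.re - R)), eventually_gt_atTop L, eventually_gt_atTop (δ + L),
    eventually_gammaFactor_arg_pos hα β] with κ hκa hκb hcR hcR' hκL hκL' hpos x hx
  have hR : 0 < R := hC.1
  have hgO : g =O[stripAtInfty (δ - κ) κ]
      fun s => Real.exp (Real.exp (θ * Real.pi * ‖s‖ / (κ - (δ - κ)))) := by
    refine (isBigO_ofReal_cpow_neg_mul hQ (hgrowth (δ - κ) κ (by linarith))).congr' ?_ .rfl
    filter_upwards [stripAtInfty_le_cobounded _ _
      (Bornology.isBounded_def.1 hFE.isCompact.isBounded)] with s hs using (hgF hs).symm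
  rw [← residualIntegral_congr hR.le (hgF.mono hC.2.1)]
  refine mellinInv_eq_residualIntegral_add_of_reflection hx hQ hR hg hθ hgO (fun s hs => ?_)
    (fun s hs => ?_) (hφ.completedSeries_isBigO_inv_sq hr hα hκa hpos)
    (hψ.star.completedSeries_isBigO_inv_sq hr hα hκb (by simpa only [conj_re] using hpos))
    (by linarith) hcR
  · have hsS := hL s (hκL.le.trans (hs ▸ le_abs_self _))
    rw [hgF hsS, hFE.continuedF_eq_completedSeries hQ hsS (hs ▸ hκa) (hs ▸ hpos)]
  · have hsS := hL s ((by linarith : L ≤ -s.re).trans (neg_le_abs _))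
    exact (hgF hsS).trans <| hFE.continuedF_eq_reflection hQ hψ.pos hsS (by linarith)
      (by simpa only [hs, sub_sub_cancel] using hpos)

end FunctionalEquation

theorem theorem1p1_general {r : ℕ} (hr : 0 < r)
    (a b : ℕ → ℂ) (lam mu : ℕ → ℝ) (σa σb : ℝ)
    (hφ : IsDirichletSeries a lam σa) (hψ : IsDirichletSeries b mu σb)
    (α : Fin r → ℝ) (hα : ∀ i, 0 < α i) (β : Fin r → ℂ)
    (Q δ : ℝ) (hQ : 0 < Q) (ω : ℂ) (S : Set ℂ) (χ : ℂ → ℂ)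
    (hFE : FunctionalEquation a lam σa b mu σb α β Q δ ω S χ)
    (c : ℂ) (R : ℝ) (hC : CircleEnclosesSingularities S (continuedF Q χ) c R)
    (κ : ℝ) (hκ : ∀ i, 0 < α i * κ + (β i).re) :
    IsResidualFunction S (residualIntegral (continuedF Q χ) c R) ∧
    ∀ x : ℝ, 0 < x →
      VerticalIntegrable (fun s => (x : ℂ) ^ (-s) * gammaFactor α β s) κ ∧
      VerticalIntegrable
        (fun s => (x : ℂ) ^ (-s) * gammaFactor α (fun i => (starRingEnd ℂ) (β i)) s) κ ∧
      Summable (fun n => a n * zFun α β κ (lam n * x)) ∧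
      Summable (fun n => (starRingEnd ℂ) (b n) *
        zFun α (fun i => (starRingEnd ℂ) (β i)) κ (mu n / (Q ^ 2 * x))) ∧
      ∑' n, a n * zFun α β κ (lam n * x) =
        residualIntegral (continuedF Q χ) c R x +
          ω / (((x * Q) ^ δ : ℝ) : ℂ) *
            ∑' n, (starRingEnd ℂ) (b n) *
              zFun α (fun i => (starRingEnd ℂ) (β i)) κ (mu n / (Q ^ 2 * x)) := by
  have hconj : ∀ {p : ℝ}, (∀ i, 0 < α i * p + (β i).re) →
      ∀ i, 0 < α i * p + ((starRingEnd ℂ) (β i)).re := fun h => by simpa only [conj_re] using h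
  refine ⟨isResidualFunction_residualIntegral hFE.isCompact
    (analyticOnNhd_continuedF hQ hFE.analytic) hC, fun x hx => ?_⟩
  obtain ⟨κ', hσa, hσb, hκ', hmodular⟩ := ((eventually_gt_atTop σa).and <|
    (eventually_gt_atTop σb).and <| (eventually_gammaFactor_arg_pos hα β).and <|
      hFE.eventually_mellinInv_eq hr hφ hψ hα hQ hC).exists
  have hsum := hφ.hasSum_mul_zFun hr hα hκ hσa hκ' hx
  have hsum_dual := hψ.star.hasSum_mul_zFun hr hα (hconj hκ) hσb (hconj hκ')
    (x := 1 / (Q ^ 2 * x)) (by positivity)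
  simp only [mul_one_div] at hsum_dual
  refine ⟨verticalIntegrable_cpow_neg_mul hx (verticalIntegrable_gammaFactor hr hα hκ),
    verticalIntegrable_cpow_neg_mul hx (verticalIntegrable_gammaFactor hr hα (hconj hκ)),
    hsum.summable, hsum_dual.summable, ?_⟩
  rw [hsum.tsum_eq, hsum_dual.tsum_eq, hmodular x hx]

theorem theorem1p1 {r : ℕ} (hr : 0 < r)
    (a b : ℕ → ℂ) (lam mu : ℕ → ℝ) (σa σb : ℝ)
    (hφ : IsDirichletSeries a lam σa) (hψ : IsDirichletSeries b mu σb)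
    (α : Fin r → ℝ) (hα : ∀ i, 0 < α i) (β : Fin r → ℂ) (hβ : ∀ i, 0 ≤ (β i).re)
    (Q δ : ℝ) (hQ : 0 < Q) (hδ : 0 < δ) (ω : ℂ) (hω : ‖ω‖ = 1)
    (S : Set ℂ) (χ : ℂ → ℂ)
    (hFE : FunctionalEquation a lam σa b mu σb α β Q δ ω S χ)
    (c : ℂ) (R : ℝ) (hC : CircleEnclosesSingularities S (continuedF Q χ) c R)
    (κ : ℝ) (hκ : 0 < κ) :
    IsResidualFunction S (residualIntegral (continuedF Q χ) c R) ∧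
    ∀ x : ℝ, 0 < x →
      VerticalIntegrable (fun s => (x : ℂ) ^ (-s) * gammaFactor α β s) κ ∧
      VerticalIntegrable
        (fun s => (x : ℂ) ^ (-s) * gammaFactor α (fun i => (starRingEnd ℂ) (β i)) s) κ ∧
      Summable (fun n => a n * zFun α β κ (lam n * x)) ∧
      Summable (fun n => (starRingEnd ℂ) (b n) *
        zFun α (fun i => (starRingEnd ℂ) (β i)) κ (mu n / (Q ^ 2 * x))) ∧
      ∑' n, a n * zFun α β κ (lam n * x) =
        residualIntegral (continuedF Q χ) c R x +
          ω / (((x * Q) ^ δ : ℝ) : ℂ) *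
            ∑' n, (starRingEnd ℂ) (b n) *
              zFun α (fun i => (starRingEnd ℂ) (β i)) κ (mu n / (Q ^ 2 * x)) :=
  theorem1p1_general hr a b lam mu σa σb hφ hψ α hα β Q δ hQ ω S χ hFE c R hC κ fun i =>
    add_pos_of_pos_of_nonneg (mul_pos (hα i) hκ) (hβ i)
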